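/- **Setting.** Let $\mathcal N$ be a finite non-empty set of agents with a fixed priority order, and let each agent arrive independently with probability $p\in(0,1]$; $S\subseteq\mathcal N$ is the random set of arriving agents and $\tilde n=p|\mathcal N|=\mathbb E|S|$. An instance is a finite set $M=\{1,\dots,m\}$ of machines with 4-step cost functions $c_j:\mathbb N\to[0,\infty]$: $c_j(0)=0$, $c_j(\ell)>0$ for $\ell\ge 1$, $c_j$ is non-decreasing, and the positive integers split into consecutive intervals of finite length at least $4$ on each of which $c_j$ is constant. (The value $\infty$ models capacities.) Instances are assumed feasible: all of $\mathcal N$ can be scheduled at finite total cost. A resource-aware cost-sharing mechanism assigns to every machine $j$ and every set $T$ of agents using $j$ the non-negative shares $\xi_{j,T}(i)\in[0,\infty]$, $i\in T$, with $\sum_{i\in T}\xi_{j,T}(i)\ge c_j(|T|)$. The shares may depend on $\mathcal N$, $p$, the machines and all cost functions, but not on the agents using other machines. The mechanism *uses the set $D\subseteq\mathcal N$ of enforcers* if, apart from the priority order, it distinguishes agents only by membership in $D$: the share of $i\in T$ on $j$ is determined by the cost functions, $j$, the numbers $|T\cap D|$ and $|T\setminus D|$, whether $i\in D$, and the priority rank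 of $i$ among the agents of its own kind (enforcer or regular) in $T$. The mechanism is *stable* if the game induced by every feasible instance and every $S\subseteq\mathcal N$, in which each agent of $S$ chooses a machine and wants to minimize its own share, has a pure Nash equilibrium. For a game, let $\mathrm{PoA}$ be the largest total of the shares in a pure Nash equilibrium divided by the smallest total machine cost $\sum_j c_j(\ell_j)$ of a schedule of $S$ (and $0$ if $S=\emptyset$), and let $\mathrm{ExpectedPoA}=\sup_{M,\mathbf c}\mathbb E_S[\mathrm{PoA}]$ over all feasible instances. **Theorem.** There is an absolute constant $K>0$ such that for all $\mathcal N$ and $p$ as above and every set $D\subseteq\mathcal N$ with $$|D|=\min\Big\{|\mathcal N|,\ \max\Big\{0,\ 3+\Big\lfloor \frac{3\log(p|\mathcal N|)}{-\log(1-p)}\Big\rfloor\Big\}\Big\}$$ (the quotient being read as $0$ if $p=1$) there is a stable resource-aware cost-sharing mechanism that uses $D$ as its set of enforcers and satisfies $$\mathrm{ExpectedPoA}\le K\,\bigl(1+\max\{0,\log\tilde n\}\bigr).$$ In particular $\mathrm{ExpectedPoA}=O(\log\tilde n)$, uniformly over $\tilde n\ge 2$. -/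

import Mathlib

open scoped ENNReal

namespace CostSharing

/-- A cost function gives the cost of a machine as a function of its load; the value `∞` is allowed,
so that machines with a hard capacity are covered. -/
abbrev CostFn := ℕ → ℝ≥0∞

/-- A 4-step cost function: it vanishes at load zero, is positive at positive loads, is
non-decreasing, and the positive loads split into consecutive steps (the `k`-th one of length
`len k ≥ 4`, `k = 0, 1, …`) on each of which the function is constant. -/
structure IsFourStep (c : CostFn) : Prop where
  zero : c 0 = 0
  pos : ∀ l, 1 ≤ l → 0 < c l
  mono : Monotone c
  steps : ∃ len : ℕ → ℕ, (∀ k, 4 ≤ len k) ∧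
    ∀ k x, ∑ k' ∈ Finset.range k, len k' < x → x ≤ ∑ k' ∈ Finset.range (k + 1), len k' →
      c x = c (∑ k' ∈ Finset.range (k + 1), len k')

section Games

variable {A : Type*} [LinearOrder A]

/-- A schedule of the agents of `S` on `m` machines. -/
abbrev Profile (S : Finset A) (m : ℕ) := S → Fin m

/-- The set of agents that use machine `j` in the profile `s`. -/
def users {S : Finset A} {m : ℕ} (s : Profile S m) (j : Fin m) : Finset A :=
  (Finset.univ.filter fun i : S => s i = j).map (Function.Embedding.subtype _)

/-- The total cost generated by a profile. -/
noncomputable def genCost {S : Finset A} {m : ℕ} (c : Fin m → CostFn) (s : Profile S m) : ℝ≥0∞ :=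
  ∑ j, c j (users s j).card

/-- The least cost of a schedule of the agents of `S` (`∞` if there is no schedule). -/
noncomputable def optCost {m : ℕ} (c : Fin m → CostFn) (S : Finset A) : ℝ≥0∞ :=
  ⨅ s : Profile S m, genCost c s

/-- The admissible choices of machines: all cost functions are 4-step, and the whole universe of
agents can be scheduled at a finite cost. -/
def Admissible (A : Type*) [LinearOrder A] [Fintype A] {m : ℕ}
    (c : Fin m → CostFn) : Prop :=
  (∀ j, IsFourStep (c j)) ∧ optCost c (Finset.univ : Finset A) ≠ ∞

/-- The probability that exactly the agents of `S` arrive, when each agent arrives independently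
with probability `p`. -/
noncomputable def arrivalProb [Fintype A] (p : ℝ) (S : Finset A) : ℝ≥0∞ :=
  ENNReal.ofReal (p ^ S.card * (1 - p) ^ (Fintype.card A - S.card))

/-- A resource-aware cost-sharing mechanism for the universe `A` of agents: `share c j T i` is what
agent `i ∈ T` pays on machine `j` when `T` is the set of the agents that use `j`. It may depend on
all machines and their cost functions, but not on the agents that use other machines. -/
structure Mechanism (A : Type*) where
  share : ∀ {m : ℕ}, (Fin m → CostFn) → Fin m → Finset A → A → ℝ≥0∞

namespace Mechanism

variable (X : Mechanism A)

/-- The cost share of agent `i` in the profile `s`. -/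
def pay {S : Finset A} {m : ℕ} (c : Fin m → CostFn) (s : Profile S m) (i : S) : ℝ≥0∞ :=
  X.share c (s i) (users s (s i)) i

/-- The total cost suffered by the agents. -/
noncomputable def socialCost {S : Finset A} {m : ℕ} (c : Fin m → CostFn) (s : Profile S m) : ℝ≥0∞ :=
  ∑ i : S, X.pay c s i

/-- The users of a machine pay at least its cost (more is allowed: overcharging). -/
def CoversCosts : Prop :=
  ∀ (m : ℕ) (c : Fin m → CostFn), (∀ j, IsFourStep (c j)) →
    ∀ (j : Fin m) (T : Finset A), c j T.card ≤ ∑ i ∈ T, X.share c j T i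

/-- Pure Nash equilibria of the game played by the agents of `S`. -/
def IsPNE {S : Finset A} {m : ℕ} (c : Fin m → CostFn) (s : Profile S m) : Prop :=
  ∀ (i : S) (j : Fin m), X.pay c s i ≤ X.pay c (Function.update s i j) i

/-- The price of anarchy of the game played by the agents of `S`. For `S ≠ ∅` and positive cost
functions the denominator is positive; for `S = ∅` both costs are zero and the value is `0`. -/
noncomputable def PoA {m : ℕ} (c : Fin m → CostFn) (S : Finset A) : ℝ≥0∞ :=
  (⨆ s : Profile S m, ⨆ _ : X.IsPNE c s, X.socialCost c s) / optCost c S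

/-- The rank of `i` in the priority order of `A` among the agents of `T` with the same role
(enforcer, i.e. in `D`, or regular) as `i`; the rank of the first such agent is zero. -/
def roleRank (D T : Finset A) (i : A) : ℕ :=
  (T.filter fun k => (k ∈ D ↔ i ∈ D) ∧ k < i).card

/-- The mechanism uses `D` as its set of enforcers: apart from membership in `D` and the priority
order, it does not distinguish the agents. The share of an agent on a machine is determined by the
cost functions, the machine, the numbers of enforcers and of regular agents on it, the role of the
agent, and its priority rank among the agents of its own role on that machine. -/
def UsesEnforcers (D : Finset A) : Prop :=
  ∀ (m : ℕ) (c : Fin m → CostFn) (j : Fin m) (T T' : Finset A) (i i' : A),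
    i ∈ T → i' ∈ T' → (i ∈ D ↔ i' ∈ D) →
    (T ∩ D).card = (T' ∩ D).card → (T \ D).card = (T' \ D).card →
    roleRank D T i = roleRank D T' i' →
    X.share c j T i = X.share c j T' i'

variable [Fintype A]

/-- Every game of the class has a pure Nash equilibrium, whatever set of agents arrives. -/
def Stable : Prop :=
  ∀ (m : ℕ) (c : Fin m → CostFn), Admissible A c →
    ∀ S : Finset A, ∃ s : Profile S m, X.IsPNE c s

/-- The expected price of anarchy: the supremum over the machines and their cost functions of the
expectation of the price of anarchy over the random set of arriving agents. -/
noncomputable def expectedPoA (p : ℝ) : ℝ≥0∞ :=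
  ⨆ (m : ℕ) (c : Fin m → CostFn) (_ : Admissible A c),
    ∑ S : Finset A, arrivalProb p S * X.PoA c S

end Mechanism

/-- The number `3 + ⌊3 log (p n) / (- log (1 - p))⌋` of enforcers for `n` agents, cut off at `0`
and at `n`. For `p = 1` the quotient is `0`, its limit as `p → 1` from below. -/
noncomputable def numEnforcers (n : ℕ) (p : ℝ) : ℕ :=
  min n (3 + ⌊3 * Real.log (p * n) / (- Real.log (1 - p))⌋).toNat

end Games

end CostSharing

namespace CostSharing

/-! True costs are replaced by slot weights (`Weighting`) in units of `β`. The heaviest slot used by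
a greedy filling has `β`-weight at most four times the optimum, while all machines of weight at most
`x` together cost at most `2βx`. Finite weights never tie across machines, and they are constant on
blocks of length at least four. They come from nested load vectors, one per budget `2 ^ r * b`
(`exists_levels`, `exists_weighting_of_cost`).

On a machine of weight `w`, the default charge `4βw` falls on every enforcer and on the first and
last regular agent. Let `M` be the top weight of the greedy filling for `S`. In any equilibrium
either all weights are at most `M` or some slot of weight at most `M` is free, so everyone pays at
most `4βM` (`UsersPNE.share_le`), and the price of anarchy is at most `16|S|`. To do better, the
machines whose payers are not charged by weight must be controlled: a full machine (load at the end
of a block) with at most one enforcer asks regulars only for the true cost, so it could be too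
heavy. Enforcers prevent this. Joining a full machine as its only enforcer costs `β(1 + 1/w)`, which
is cheaper the heavier the machine is. The only cheaper resting place for every enforcer is to be
alone on a full machine at price `β`, but of two such enforcers the later one would join the other
for free. So two enforcers exclude full machines without enforcers above weight `M`
(`UsersPNE.weight_le`). The total then consists of charges to enforcer machines, at most one
non-full machine, and light full machines, giving `48(1 + |S ∩ D|)` (`PoA_le_poaBound`).

Equilibria are built on greedy fillings (`exists_usersPNE`). Regulars are sorted along the machines
so that a newcomer is always first or last, hence a payer. Enforcers sit in pairs near block ends,
where the discounts live; a nearly full machine with fewer than two enforcers is handled by moving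
the vacancy elsewhere.

In expectation, `p|D|` is logarithmic, and fewer than two enforcers arrive so rarely that the bound
`16|S|` also contributes only a logarithm. -/

/-- A weight function of a machine: it vanishes at load zero, is at least one at positive loads,
non-decreasing, and constant on blocks of length at least four. -/
structure IsBlockWeight (w : ℕ → ℝ≥0∞) : Prop where
  zero : w 0 = 0
  one_le : ∀ l, 1 ≤ l → 1 ≤ w l
  mono : Monotone w
  four : ∀ l, w l < w (l + 1) → w (l + 4) = w (l + 1)

/-- Weights of the slots of all machines that order the slots by the (approximate) cost of the
schedules in which they are needed, `β` being the unit of cost. -/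
structure Weighting {m : ℕ} (c : Fin m → CostFn) (n : ℕ) (β : ℝ≥0∞) (w : Fin m → ℕ → ℝ≥0∞) :
    Prop where
  pos : β ≠ 0
  fin : β ≠ ∞
  block : ∀ j, IsBlockWeight (w j)
  ne : ∀ j j' l l', 1 ≤ l → 1 ≤ l' → j ≠ j' → w j l = w j' l' → w j l = ∞
  cover : ∀ j l, c j l ≤ β * w j l
  light_sum : ∀ (u : Fin m → ℕ) (x : ℝ≥0∞),
    ∑ j with w j (u j) ≤ x, c j (u j) ≤ β * (2 * x)
  greedy : ∀ u : Fin m → ℕ, ∑ j, u j ≤ n → (∀ j j', w j (u j) ≤ w j' (u j' + 1)) →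
    ∀ j, w j (u j) ≠ ∞ ∧
      ∀ u' : Fin m → ℕ, ∑ j, u' j = ∑ j, u j → β * w j (u j) ≤ 4 * ∑ j, c j (u' j)

/-! ### Slot weights from nested load vectors -/

/-- The set of the ends of the steps of a 4-step cost function, together with `0`. -/
def stepEnds (len : ℕ → ℕ) : Set ℕ := {l | ∃ k, l = ∑ k' ∈ Finset.range k, len k'}

/-- Rounding a load up to the end of its step is free. The gaps of at least four between step ends
later become the block lengths of the weights. -/
theorem exists_stepEnds {c : CostFn} (hc : IsFourStep c) :
    ∃ E : Set ℕ, 0 ∈ E ∧ (∀ e ∈ E, ∀ f ∈ E, e < f → e + 4 ≤ f) ∧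
      ∀ l, ∃ e ∈ E, l ≤ e ∧ c e = c l := by
  obtain ⟨len, h4, hs⟩ := hc.steps
  have hmono : Monotone fun k => ∑ k' ∈ Finset.range k, len k' :=
    monotone_nat_of_le_succ fun k => by rw [Finset.sum_range_succ]; omega
  have hge : ∀ k, k ≤ ∑ k' ∈ Finset.range k, len k' := by
    intro k
    induction k with
    | zero => simp
    | succ k ih => rw [Finset.sum_range_succ]; have := h4 k; omega
  refine ⟨stepEnds len, ⟨0, by simp⟩, ?_, ?_⟩
  · rintro _ ⟨k, rfl⟩ _ ⟨k', rfl⟩ hlt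
    have hk : k < k' := by
      by_contra h
      exact absurd (hmono (not_lt.1 h)) (not_le.2 hlt)
    have := hmono (Nat.succ_le_of_lt hk)
    simp only [Finset.sum_range_succ, Nat.succ_eq_add_one] at this
    have := h4 k
    omega
  · intro l
    have hex : ∃ k, l ≤ ∑ k' ∈ Finset.range k, len k' := ⟨l, hge l⟩
    refine ⟨_, ⟨Nat.find hex, rfl⟩, Nat.find_spec hex, ?_⟩
    rcases h : Nat.find hex with _ | k
    · have := Nat.find_spec hex
      rw [h] at this
      simp at this
      simp [this]
    · have h1 := Nat.find_spec hex
      have h2 := Nat.find_min hex (m := k) (by omega)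
      rw [h] at h1
      exact (hs k l (not_le.1 h2) h1).symm

theorem exists_pow_two_mul_ge {x b : ℝ≥0∞} (hx : x ≠ ∞) (hb : b ≠ 0) : ∃ r : ℕ, x ≤ 2 ^ r * b := by
  obtain ⟨k, hk⟩ := ENNReal.exists_nat_mul_gt hb hx
  refine ⟨k, hk.le.trans ?_⟩
  gcongr
  exact_mod_cast (Nat.lt_two_pow_self (n := k)).le

/-- Nested load vectors `L 0 ≤ L 1 ≤ …` such that `L r` has at least the size of every load vector
of cost at most `2 ^ r` (in units of `b`) and a cost of the same order. -/
theorem exists_levels {m : ℕ} {c : Fin m → CostFn} (hc : ∀ j, IsFourStep (c j)) (n : ℕ)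
    (b : ℝ≥0∞) :
    ∃ (E : Fin m → Set ℕ) (L : ℕ → Fin m → ℕ),
      (∀ j, 0 ∈ E j) ∧ (∀ j, ∀ e ∈ E j, ∀ f ∈ E j, e < f → e + 4 ≤ f) ∧
      (∀ r j, L r j ∈ E j) ∧ (∀ j, Monotone fun r => L r j) ∧
      (∀ r j, c j (L r j) ≤ 2 ^ r * b) ∧
      (∀ r, ∑ j, c j (L r j) ≤ 2 ^ (r + 1) * b) ∧
      (∀ r (u : Fin m → ℕ), ∑ j, u j ≤ n → ∑ j, c j (u j) ≤ 2 ^ r * b → ∑ j, u j ≤ ∑ j, L r j) := by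
  classical
  choose E hE0 hE4 hEr using fun j => exists_stepEnds (hc j)
  have hV : ∀ r : ℕ, ∃ V : Fin m → ℕ, (∀ j, V j ∈ E j) ∧ ∑ j, c j (V j) ≤ 2 ^ r * b ∧
      ∀ u : Fin m → ℕ, ∑ j, u j ≤ n → ∑ j, c j (u j) ≤ 2 ^ r * b → ∑ j, u j ≤ ∑ j, V j := by
    intro r
    -- A load vector of largest size within the budget is rounded up to step ends at no cost; the
    -- cap `n` makes the maximum exist even if the sizes within the budget are unbounded.
    let P : ℕ → Prop := fun k => ∃ u : Fin m → ℕ, ∑ j, u j = k ∧ ∑ j, c j (u j) ≤ 2 ^ r * b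
    have hP0 : P 0 := ⟨fun _ => 0, by simp, by simp [(hc _).zero]⟩
    obtain ⟨u, hu, hcu⟩ := Nat.findGreatest_spec (P := P) (Nat.zero_le n) hP0
    choose V hVE hVl hVc using fun j => hEr j (u j)
    refine ⟨V, hVE, by simpa [hVc] using hcu, fun u' hn hu' => ?_⟩
    have h1 : ∑ j, u' j ≤ Nat.findGreatest P n := Nat.le_findGreatest hn ⟨u', rfl, hu'⟩
    exact h1.trans (hu ▸ Finset.sum_le_sum fun j _ => hVl j)
  choose V hVE hVc hVu using hV
  -- Running maxima make the vectors nested. Budgets double, so the accumulated cost is geometric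
  -- and stays within twice the last budget.
  let L : ℕ → Fin m → ℕ := fun r j => Nat.rec (V 0 j) (fun k x => max x (V (k + 1) j)) r
  have hLs : ∀ r j, L (r + 1) j = max (L r j) (V (r + 1) j) := fun _ _ => rfl
  have hVL : ∀ r j, V r j ≤ L r j := by
    intro r j
    cases r with
    | zero => exact le_rfl
    | succ r => rw [hLs]; exact le_max_right _ _
  have hone : ∀ r j, c j (V r j) ≤ 2 ^ r * b := fun r j =>
    (Finset.single_le_sum (f := fun j => c j (V r j)) (fun _ _ => zero_le) (Finset.mem_univ j)).trans
      (hVc r)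
  refine ⟨E, L, hE0, hE4, ?_, ?_, ?_, ?_, ?_⟩
  · intro r j
    induction r with
    | zero => exact hVE 0 j
    | succ r ih =>
      rw [hLs]
      rcases max_choice (L r j) (V (r + 1) j) with h | h <;> rw [h]
      exacts [ih, hVE _ _]
  · exact fun j => monotone_nat_of_le_succ fun r => by rw [hLs]; exact le_max_left _ _
  · intro r j
    induction r with
    | zero => exact hone 0 j
    | succ r ih =>
      rw [hLs, (hc j).mono.map_max]
      refine max_le (ih.trans ?_) (hone _ _)
      gcongr
      · exact one_le_two
      · omega
  · intro r
    induction r with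
    | zero =>
      refine (hVc 0).trans ?_
      gcongr
      · exact one_le_two
      · omega
    | succ r ih =>
      calc ∑ j, c j (L (r + 1) j) ≤ ∑ j, (c j (L r j) + c j (V (r + 1) j)) := by
            refine Finset.sum_le_sum fun j _ => ?_
            rw [hLs, (hc j).mono.map_max]
            exact max_le le_self_add le_add_self
        _ ≤ 2 ^ (r + 1) * b + 2 ^ (r + 1) * b := by
            rw [Finset.sum_add_distrib]
            exact add_le_add ih (hVc _)
        _ = 2 ^ (r + 1 + 1) * b := by ring
  · exact fun r u hn hu => (hVu r u hn hu).trans (Finset.sum_le_sum fun j _ => hVL r j)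

/-- The weight of the slot at level `r` of the machine `j`. -/
def levelWeight (m r j : ℕ) : ℕ := 2 ^ r * (m + j)

/-- The summand `j < m` breaks ties inside a level without reaching the factor two that separates
levels. -/
theorem levelWeight_lt {m r r' j j' : ℕ} (hj : j < m) (h : r < r') :
    levelWeight m r j < levelWeight m r' j' := by
  unfold levelWeight
  calc 2 ^ r * (m + j) < 2 ^ r * (2 * m) := by gcongr; omega
    _ = 2 ^ (r + 1) * m := by ring
    _ ≤ 2 ^ r' * (m + j') := by gcongr <;> omega

theorem levelWeight_inj {m r r' j j' : ℕ} (hj : j < m) (hj' : j' < m)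
    (h : levelWeight m r j = levelWeight m r' j') : r = r' ∧ j = j' := by
  rcases lt_trichotomy r r' with h1 | rfl | h1
  · exact absurd h (levelWeight_lt hj h1).ne
  · refine ⟨rfl, ?_⟩
    unfold levelWeight at h
    have := Nat.eq_of_mul_eq_mul_left (by positivity) h
    omega
  · exact absurd h (levelWeight_lt hj' h1).ne'

open Classical in
/-- The weights belonging to nested load vectors. -/
noncomputable def nestedWeight {m : ℕ} (L : ℕ → Fin m → ℕ) (j : Fin m) (l : ℕ) : ℝ≥0∞ :=
  if l = 0 then 0 else if h : ∃ r, l ≤ L r j then (levelWeight m (Nat.find h) j : ℝ≥0∞) else ∞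

section NestedWeight

variable {m : ℕ} {L : ℕ → Fin m → ℕ} {j : Fin m} {l : ℕ}

theorem nestedWeight_zero : nestedWeight L j 0 = 0 := by simp [nestedWeight]

theorem exists_level_of_nestedWeight (hl : 1 ≤ l) (h : nestedWeight L j l ≠ ∞) :
    ∃ r, l ≤ L r j ∧ nestedWeight L j l = (levelWeight m r j : ℝ≥0∞) := by
  unfold nestedWeight at h ⊢
  rw [if_neg (by omega)] at h ⊢
  split_ifs at h ⊢ with h1
  · exact ⟨_, Nat.find_spec h1, rfl⟩
  · exact absurd rfl h

theorem nestedWeight_le {r : ℕ} (h : l ≤ L r j) :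
    nestedWeight L j l ≤ (levelWeight m r j : ℝ≥0∞) := by
  classical
  unfold nestedWeight
  have h1 : ∃ r, l ≤ L r j := ⟨r, h⟩
  split_ifs
  · simp
  · have := Nat.find_min' h1 h
    unfold levelWeight
    norm_cast
    gcongr
    norm_num

theorem nestedWeight_block {E : Fin m → Set ℕ} (hE0 : ∀ j, 0 ∈ E j)
    (hE4 : ∀ j, ∀ e ∈ E j, ∀ f ∈ E j, e < f → e + 4 ≤ f) (hL : ∀ r j, L r j ∈ E j) (j : Fin m) :
    IsBlockWeight (nestedWeight L j) := by
  have hone : ∀ l, 1 ≤ l → 1 ≤ nestedWeight L j l := by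
    intro l hl
    by_cases h : nestedWeight L j l = ∞
    · simp [h]
    obtain ⟨r, -, h⟩ := exists_level_of_nestedWeight hl h
    rw [h]
    have : 1 ≤ levelWeight m r j := by
      have := j.pos
      exact Nat.mul_pos (by positivity) (by omega)
    exact_mod_cast this
  have hmono : Monotone (nestedWeight L j) := by
    intro l l' hll
    rcases Nat.eq_zero_or_pos l with rfl | hl
    · simp [nestedWeight_zero]
    by_cases h : nestedWeight L j l' = ∞
    · simp [h]
    obtain ⟨r, hr, h⟩ := exists_level_of_nestedWeight (by omega) h
    rw [h]
    exact nestedWeight_le (hll.trans hr)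
  refine ⟨nestedWeight_zero, hone, hmono, fun l hlt => le_antisymm ?_ (hmono (by omega))⟩
  by_cases h : nestedWeight L j (l + 1) = ∞
  · simp [h]
  obtain ⟨r, hr, h⟩ := exists_level_of_nestedWeight (by omega) h
  rw [h]
  apply nestedWeight_le
  -- A jump after `l` means that `l` is zero or the last slot of its level, hence a step end; any
  -- level reaching `l + 1` ends at least four slots later.
  have hlE : l ∈ E j := by
    rcases Nat.eq_zero_or_pos l with rfl | hl
    · exact hE0 j
    obtain ⟨r', hr', h'⟩ := exists_level_of_nestedWeight hl hlt.ne_top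
    have : ¬ l + 1 ≤ L r' j := fun hh => not_lt.2 (nestedWeight_le hh) (h' ▸ hlt)
    have : l = L r' j := by omega
    exact this ▸ hL r' j
  exact hE4 j l hlE _ (hL r j) hr

end NestedWeight

theorem exists_weighting_of_cost {m : ℕ} {c : Fin m → CostFn} (hc : ∀ j, IsFourStep (c j)) {n : ℕ}
    (hn : 1 ≤ n) {u₀ : Fin m → ℕ} (hu₀ : ∑ j, u₀ j = n) (hcost : ∑ j, c j (u₀ j) ≠ ∞) :
    ∃ β w, Weighting c n β w := by
  classical
  have hpos : ∀ u : Fin m → ℕ, 1 ≤ ∑ j, u j → ∃ j, 1 ≤ u j := by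
    intro u hu
    by_contra! h
    have : ∑ j, u j = 0 := Finset.sum_eq_zero fun j _ => by have := h j; omega
    omega
  obtain ⟨i₀, hi₀⟩ := hpos u₀ (hu₀ ▸ hn)
  have hle : ∀ (u : Fin m → ℕ) j, c j (u j) ≤ ∑ j, c j (u j) := fun u j =>
    Finset.single_le_sum (f := fun j => c j (u j)) (fun _ _ => zero_le) (Finset.mem_univ j)
  have : Nonempty (Fin m) := ⟨i₀⟩
  have hm : 1 ≤ m := i₀.pos
  obtain ⟨j₀, hj₀⟩ := Finite.exists_min fun j => c j 1
  -- This is the least cost of serving one agent, so it bounds every nonempty schedule from below.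
  -- With `β = b / m`, a slot of level `r` gets `β`-weight between `2 ^ r * b` and `2 ^ (r + 1) *
  -- b`.
  set b := c j₀ 1 with hb
  have hb0 : b ≠ 0 := ((hc j₀).pos 1 le_rfl).ne'
  have hbt : b ≠ ∞ := by
    refine ne_top_of_le_ne_top hcost ((hj₀ i₀).trans (((hc i₀).mono hi₀).trans (hle u₀ i₀)))
  have hbc : ∀ u : Fin m → ℕ, 1 ≤ ∑ j, u j → b ≤ ∑ j, c j (u j) := by
    intro u hu
    obtain ⟨j, hj⟩ := hpos u hu
    exact (hj₀ j).trans (((hc j).mono hj).trans (hle u j))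
  obtain ⟨E, L, hE0, hE4, hLE, hLm, hLc, hLs, hLu⟩ := exists_levels hc n b
  have hm0 : (m : ℝ≥0∞) ≠ 0 := by exact_mod_cast (by omega : m ≠ 0)
  have hmt : (m : ℝ≥0∞) ≠ ∞ := ENNReal.natCast_ne_top m
  have hbm : b / m * m = b := ENNReal.div_mul_cancel hm0 hmt
  have hβ0 : b / m ≠ 0 := ENNReal.div_ne_zero.2 ⟨hb0, hmt⟩
  have hlow : ∀ r (j : Fin m), 2 ^ r * b ≤ b / m * (levelWeight m r j : ℝ≥0∞) := by
    intro r j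
    calc 2 ^ r * b = b / m * (2 ^ r * m) := by rw [mul_left_comm, hbm]
      _ ≤ b / m * (levelWeight m r j : ℝ≥0∞) := by
        gcongr
        unfold levelWeight
        push_cast
        gcongr
        exact le_self_add
  have hhigh : ∀ r (j : Fin m), b / m * (levelWeight m r j : ℝ≥0∞) ≤ 2 ^ (r + 1) * b := by
    intro r j
    calc b / m * (levelWeight m r j : ℝ≥0∞) ≤ b / m * (2 ^ r * (m + m)) := by
          gcongr
          unfold levelWeight
          push_cast
          gcongr
          exact_mod_cast j.2.le
      _ = 2 ^ (r + 1) * (b / m * m) := by ring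
      _ = 2 ^ (r + 1) * b := by rw [hbm]
  have hblock := nestedWeight_block hE0 hE4 hLE
  refine ⟨b / m, nestedWeight L, hβ0, ENNReal.div_ne_top hbt hm0, hblock, ?_, ?_, ?_, ?_⟩
  · intro j j' l l' hl hl' hjj h
    by_contra hfin
    obtain ⟨r, -, h1⟩ := exists_level_of_nestedWeight hl hfin
    obtain ⟨r', -, h2⟩ := exists_level_of_nestedWeight hl' (h ▸ hfin)
    rw [h1, h2] at h
    exact hjj (Fin.ext (levelWeight_inj j.2 j'.2 (by exact_mod_cast h)).2)
  · intro j l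
    rcases Nat.eq_zero_or_pos l with rfl | hl
    · simp [(hc j).zero]
    by_cases hfin : nestedWeight L j l = ∞
    · simp [hfin, ENNReal.mul_top hβ0]
    obtain ⟨r, hr, h⟩ := exists_level_of_nestedWeight hl hfin
    rw [h]
    exact ((hc j).mono hr).trans ((hLc r j).trans (hlow r j))
  · intro u x
    by_cases hx : x = ∞
    · simp [hx, ENNReal.mul_top hβ0]
    set F := Finset.univ.filter fun j => nestedWeight L j (u j) ≤ x ∧ 1 ≤ u j with hF
    have hsub : ∑ j with nestedWeight L j (u j) ≤ x, c j (u j) = ∑ j ∈ F, c j (u j) := by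
      symm
      apply Finset.sum_subset
      · intro j; simp +contextual [hF]
      · intro j h1 h2
        simp only [hF, Finset.mem_filter, Finset.mem_univ, true_and, not_and] at h1 h2
        have : u j = 0 := by have := h2 h1; omega
        simp [this, (hc j).zero]
    rw [hsub]
    have hlev : ∀ j ∈ F, ∃ r, u j ≤ L r j ∧ nestedWeight L j (u j) = (levelWeight m r j : ℝ≥0∞) := by
      intro j hj
      simp only [hF, Finset.mem_filter, Finset.mem_univ, true_and] at hj
      exact exists_level_of_nestedWeight hj.2 (ne_top_of_le_ne_top hx hj.1)
    choose! ρ hρ1 hρ2 using hlev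
    rcases F.eq_empty_or_nonempty with hF0 | hF0
    · simp [hF0]
    -- By nestedness all these loads lie below the single vector of the highest level present. Its
    -- total cost is comparable to the weight of one slot, so the number of machines does not enter.
    obtain ⟨j₁, hj₁, hmax⟩ := F.exists_max_image ρ hF0
    have hxj : nestedWeight L j₁ (u j₁) ≤ x := (Finset.mem_filter.1 hj₁).2.1
    calc ∑ j ∈ F, c j (u j) ≤ ∑ j ∈ F, c j (L (ρ j₁) j) :=
          Finset.sum_le_sum fun j hj => (hc j).mono ((hρ1 j hj).trans (hLm j (hmax j hj)))
      _ ≤ ∑ j, c j (L (ρ j₁) j) := Finset.sum_le_sum_of_subset (Finset.subset_univ _)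
      _ ≤ 2 ^ (ρ j₁ + 1) * b := hLs _
      _ = 2 * (2 ^ ρ j₁ * b) := by ring
      _ ≤ 2 * (b / m * x) := by
          refine mul_le_mul_right ((hlow _ j₁).trans ?_) 2
          rw [← hρ2 j₁ hj₁]
          exact mul_le_mul_right hxj _
      _ = b / m * (2 * x) := by ring
  · intro u hun hg j
    rcases Nat.eq_zero_or_pos (u j) with h0 | hl
    · simp [h0, nestedWeight_zero]
    -- An infinite weight in a greedy vector means that every level is used up, with a slot to spare
    -- at `j`; but a level whose budget pays for `u₀` already has size at least `n`.
    have hfin : nestedWeight L j (u j) ≠ ∞ := by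
      intro htop
      have h1 : ∀ r j', L r j' ≤ u j' := by
        intro r j'
        by_contra h
        have := (hg j j').trans (nestedWeight_le (L := L) (j := j') (r := r) (by omega))
        rw [htop] at this
        exact absurd (top_le_iff.1 this) (ENNReal.natCast_ne_top _)
      have h2 : ∀ r, L r j < u j := by
        intro r
        by_contra h
        have := nestedWeight_le (L := L) (j := j) (r := r) (not_lt.1 h)
        rw [htop] at this
        exact absurd (top_le_iff.1 this) (ENNReal.natCast_ne_top _)
      obtain ⟨r, hr⟩ := exists_pow_two_mul_ge hcost hb0
      have h3 := hLu r u₀ hu₀.le hr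
      have h4 : ∑ j, L r j < ∑ j, u j :=
        Finset.sum_lt_sum (fun j' _ => h1 r j') ⟨j, Finset.mem_univ j, h2 r⟩
      omega
    refine ⟨hfin, fun u' hu' => ?_⟩
    obtain ⟨r, hr, h⟩ := exists_level_of_nestedWeight hl hfin
    have hsum : 1 ≤ ∑ j, u j :=
      le_trans hl (Finset.single_le_sum (f := u) (fun _ _ => Nat.zero_le _) (Finset.mem_univ j))
    rw [h]
    refine (hhigh r j).trans ?_
    rcases r with _ | r
    · calc 2 ^ (0 + 1) * b ≤ 4 * b := by gcongr; norm_num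
        _ ≤ _ := by gcongr; exact hbc u' (hu' ▸ hsum)
    -- If `u'` fitted into this budget, `L r` would be at least as large as `u`. Yet greediness
    -- fills all of `L r` before the slot of level `r + 1` at `j`, so `L r` is strictly smaller.
    · have hC : 2 ^ r * b ≤ ∑ j, c j (u' j) := by
        by_contra hlt
        have h3 := hLu r u' (hu' ▸ hun) (not_le.1 hlt).le
        have h1 : ∀ j', L r j' ≤ u j' := by
          intro j'
          by_contra hh
          have := (hg j j').trans (nestedWeight_le (L := L) (j := j') (r := r) (by omega))
          rw [h] at this
          exact absurd (levelWeight_lt (m := m) (r := r) (r' := r + 1) (j := j') (j' := j) j'.2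
            (by omega)) (not_lt.2 (by exact_mod_cast this))
        have h2 : L r j < u j := by
          by_contra hh
          have := nestedWeight_le (L := L) (j := j) (r := r) (not_lt.1 hh)
          rw [h] at this
          exact absurd (levelWeight_lt (m := m) (r := r) (r' := r + 1) (j := j) (j' := j) j.2
            (by omega)) (not_lt.2 (by exact_mod_cast this))
        have h4 : ∑ j, L r j < ∑ j, u j :=
          Finset.sum_lt_sum (fun j' _ => h1 j') ⟨j, Finset.mem_univ j, h2⟩
        omega
      calc 2 ^ (r + 1 + 1) * b = 4 * (2 ^ r * b) := by ring
        _ ≤ _ := by gcongr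

/-! ### Loads of profiles -/

section Loads

variable {A : Type*}

theorem mem_users {S : Finset A} {m : ℕ} {s : Profile S m} {j : Fin m} {i : A} :
    i ∈ users s j ↔ ∃ h : i ∈ S, s ⟨i, h⟩ = j := by
  simp [users]

theorem mem_users_self {S : Finset A} {m : ℕ} (s : Profile S m) (i : S) :
    (i : A) ∈ users s (s i) := mem_users.2 ⟨i.2, rfl⟩

theorem sum_card_users {S : Finset A} {m : ℕ} (s : Profile S m) :
    ∑ j, (users s j).card = S.card := by
  simp only [users, Finset.card_map]
  rw [← Finset.card_eq_sum_card_fiberwise (f := s) (s := Finset.univ) (t := Finset.univ) (by simp)]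
  simp

theorem Admissible.exists_weighting [LinearOrder A] [Fintype A] [Nonempty A] {m : ℕ} {c : Fin m → CostFn}
    (h : Admissible A c) : ∃ β w, Weighting c (Fintype.card A) β w := by
  have : ∃ s : Profile (Finset.univ : Finset A) m, genCost c s ≠ ∞ := by
    by_contra! hall
    exact h.2 (by simp [optCost, hall])
  obtain ⟨s, hs⟩ := this
  exact exists_weighting_of_cost h.1 Fintype.card_pos
    ((sum_card_users s).trans Finset.card_univ) hs

end Loads

/-! ### Full loads and the charging rules -/

/-- The load `l` is the end of a block of the weight function `w`. -/
def IsFull (w : ℕ → ℝ≥0∞) (l : ℕ) : Prop := 1 ≤ l ∧ w l < w (l + 1)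

namespace IsFull

variable {w : ℕ → ℝ≥0∞} {l : ℕ}

theorem four_le (h : IsFull w l) (hw : IsBlockWeight w) : 4 ≤ l := by
  by_contra hl
  have h4 : w 4 = w 1 := hw.four 0 (by
    rw [hw.zero]; exact one_pos.trans_le (hw.one_le 1 le_rfl))
  have h1 : w 1 ≤ w l := hw.mono h.1
  have h2 : w (l + 1) ≤ w 4 := hw.mono (by omega)
  exact absurd h.2 (not_lt.2 (h2.trans (h4.le.trans h1)))

/-- Block ends are at least four apart. This keeps the discounts at nearly full, full and overfull
loads from interfering after a single agent moves. -/
theorem not_add (h : IsFull w l) (hw : IsBlockWeight w) {k : ℕ} (hk : 1 ≤ k) (hk' : k ≤ 3) :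
    ¬ IsFull w (l + k) := by
  intro h'
  have h4 := hw.four l h.2
  have h1 : w (l + 1) ≤ w (l + k) := hw.mono (by omega)
  have h2 : w (l + k + 1) ≤ w (l + 4) := hw.mono (by omega)
  exact absurd h'.2 (not_lt.2 (h2.trans (h4.le.trans h1)))

end IsFull

theorem IsBlockWeight.eq_succ {w : ℕ → ℝ≥0∞} (hw : IsBlockWeight w) {l : ℕ} (hl : 1 ≤ l)
    (h : ¬ IsFull w l) : w (l + 1) = w l :=
  le_antisymm (not_lt.1 fun h' => h ⟨hl, h'⟩) (hw.mono (Nat.le_succ l))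

open Classical in
/-- The share of a regular agent of rank `q` on a machine with load `l`, used by `a` enforcers and
`b` regular agents. -/
noncomputable def regShare (c : CostFn) (β : ℝ≥0∞) (w : ℕ → ℝ≥0∞) (a b l q : ℕ) : ℝ≥0∞ :=
  if q = 0 ∨ q + 1 = b then if a ≤ 1 ∧ IsFull w l then c l else β * (4 * w l) else 0

open Classical in
/-- The share of an enforcer of rank `q` on a machine with load `l`, used by `a` enforcers. -/
noncomputable def enfShare (β : ℝ≥0∞) (w : ℕ → ℝ≥0∞) (a l q : ℕ) : ℝ≥0∞ :=
  if a = 1 ∧ IsFull w l then β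
  else if a = 1 ∧ IsFull w (l - 1) then β * (1 + (w (l - 1))⁻¹)
  else if a = 2 ∧ (IsFull w l ∨ IsFull w (l + 1)) then β * (1 + (w l)⁻¹)
  else if a = 2 ∧ IsFull w (l - 1) ∧ q = 1 then 0
  else β * (4 * w l)

section Shares

variable {c : CostFn} {β : ℝ≥0∞} {w : ℕ → ℝ≥0∞} {a b l q : ℕ}

theorem one_add_inv_le_two {x : ℝ≥0∞} (hx : 1 ≤ x) : 1 + x⁻¹ ≤ 2 := by
  calc 1 + x⁻¹ ≤ 1 + 1 := by gcongr; exact ENNReal.inv_le_one.2 hx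
    _ = 2 := one_add_one_eq_two

theorem two_le_four_mul {x : ℝ≥0∞} (hx : 1 ≤ x) : 2 ≤ 4 * x :=
  calc (2 : ℝ≥0∞) ≤ 4 * 1 := by norm_num
    _ ≤ 4 * x := by gcongr

theorem regShare_le (hc : ∀ l, c l ≤ β * w l) : regShare c β w a b l q ≤ β * (4 * w l) := by
  unfold regShare
  split_ifs
  · refine (hc l).trans ?_
    gcongr
    exact le_mul_of_one_le_left zero_le (by norm_num)
  · exact le_rfl
  · exact zero_le

theorem enfShare_le (hw : IsBlockWeight w) (hl : 1 ≤ l) :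
    enfShare β w a l q ≤ β * (4 * w l) := by
  have h1 := hw.one_le l hl
  have h2 := two_le_four_mul h1
  unfold enfShare
  split_ifs with _ h
  · exact le_mul_of_one_le_right zero_le ((by norm_num : (1 : ℝ≥0∞) ≤ 2).trans h2)
  · gcongr
    exact (one_add_inv_le_two (hw.one_le _ h.2.1)).trans h2
  · gcongr
    exact (one_add_inv_le_two h1).trans h2
  · exact zero_le
  · exact le_rfl

theorem enfShare_one_full (h : IsFull w l) : enfShare β w 1 l q = β := by
  simp [enfShare, h]

/-- This price attracts enforcers: it decreases in the weight, exceeds the price `β` of a lone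
enforcer on a full machine, and is at most `2β`, below every default charge. -/
theorem enfShare_one_over (hw : IsBlockWeight w) (h : IsFull w l) :
    enfShare β w 1 (l + 1) q = β * (1 + (w l)⁻¹) := by
  simp [enfShare, h, h.not_add hw le_rfl (by norm_num)]

theorem enfShare_one_other (h : ¬ IsFull w l) (h' : ¬ IsFull w (l - 1)) :
    enfShare β w 1 l q = β * (4 * w l) := by
  simp [enfShare, h, h']

theorem enfShare_two_full (h : IsFull w l ∨ IsFull w (l + 1)) :
    enfShare β w 2 l q = β * (1 + (w l)⁻¹) := by
  simp [enfShare, h]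

/-- The free place destabilizes pairs of lone enforcers on different full machines: the later one in
the priority order has rank one after joining the other. -/
theorem enfShare_two_over (hw : IsBlockWeight w) (h : IsFull w l) :
    enfShare β w 2 (l + 1) 1 = 0 := by
  simp [enfShare, h, h.not_add hw le_rfl (by norm_num),
    h.not_add hw (k := 2) (by norm_num) (by norm_num), add_assoc]

theorem enfShare_two_zero (h : ¬ IsFull w l) (h' : ¬ IsFull w (l + 1)) :
    enfShare β w 2 l 0 = β * (4 * w l) := by
  simp [enfShare, h, h']

theorem enfShare_two_other (h : ¬ IsFull w l) (h' : ¬ IsFull w (l + 1)) (h'' : ¬ IsFull w (l - 1)) :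
    enfShare β w 2 l q = β * (4 * w l) := by
  simp [enfShare, h, h', h'']

theorem enfShare_many (ha : 3 ≤ a) : enfShare β w a l q = β * (4 * w l) := by
  have h1 : a ≠ 1 := by omega
  have h2 : a ≠ 2 := by omega
  simp [enfShare, h1, h2]

theorem regShare_heavy (hq : q = 0 ∨ q + 1 = b) (h : ¬ (a ≤ 1 ∧ IsFull w l)) :
    regShare c β w a b l q = β * (4 * w l) := by
  rw [regShare, if_pos hq, if_neg h]

theorem regShare_light (hq : q = 0 ∨ q + 1 = b) (ha : a ≤ 1) (h : IsFull w l) :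
    regShare c β w a b l q = c l := by
  rw [regShare, if_pos hq, if_pos ⟨ha, h⟩]

end Shares

/-! ### Priority ranks -/

section Ranks

variable {A : Type*} [LinearOrder A] {D T : Finset A} {i : A}

open Mechanism

theorem roleRank_of_mem (hi : i ∈ D) :
    roleRank D T i = ((T ∩ D).filter (· < i)).card := by
  unfold roleRank
  congr 1
  ext k
  simp only [Finset.mem_filter, Finset.mem_inter]
  tauto

theorem roleRank_of_notMem (hi : i ∉ D) :
    roleRank D T i = ((T \ D).filter (· < i)).card := by
  unfold roleRank
  congr 1
  ext k
  simp only [Finset.mem_filter, Finset.mem_sdiff]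
  tauto

theorem roleRank_insert : roleRank D (insert i T) i = roleRank D T i := by
  unfold roleRank
  rw [Finset.filter_insert, if_neg (by simp)]

theorem exists_rank_zero {R : Finset A} (hR : R.Nonempty) :
    ∃ i ∈ R, (R.filter (· < i)).card = 0 :=
  ⟨R.min' hR, R.min'_mem hR, by
    rw [Finset.card_eq_zero, Finset.filter_eq_empty_iff]
    exact fun _ hk => not_lt.2 (R.min'_le _ hk)⟩

theorem sum_first_last_le (R : Finset A) (H : ℝ≥0∞) :
    ∑ i ∈ R, (if (R.filter (· < i)).card = 0 ∨ (R.filter (· < i)).card + 1 = R.card then H else 0)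
      ≤ 2 * H := by
  have h0 : (R.filter fun i => (R.filter (· < i)).card = 0).card ≤ 1 := by
    rw [Finset.card_le_one]
    intro i hi k hk
    simp only [Finset.mem_filter, Finset.card_eq_zero, Finset.filter_eq_empty_iff, not_lt] at hi hk
    exact le_antisymm (hi.2 hk.1) (hk.2 hi.1)
  have hlast : ∀ i ∈ R, (R.filter (· < i)).card + 1 = R.card → ∀ k ∈ R, k ≤ i := by
    intro i hi h k hk
    have h1 : insert i (R.filter (· < i)) = R := by
      apply Finset.eq_of_subset_of_card_le
      · exact Finset.insert_subset hi (Finset.filter_subset _ _)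
      · rw [Finset.card_insert_of_notMem (by simp), h]
    rw [← h1] at hk
    rcases Finset.mem_insert.1 hk with rfl | hk
    · exact le_rfl
    · exact (Finset.mem_filter.1 hk).2.le
  have h1 : (R.filter fun i => (R.filter (· < i)).card + 1 = R.card).card ≤ 1 := by
    rw [Finset.card_le_one]
    intro i hi k hk
    simp only [Finset.mem_filter] at hi hk
    exact le_antisymm (hlast k hk.1 hk.2 i hi.1) (hlast i hi.1 hi.2 k hk.1)
  calc _ ≤ ∑ i ∈ R, ((if (R.filter (· < i)).card = 0 then H else 0) +
          (if (R.filter (· < i)).card + 1 = R.card then H else 0)) := by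
        refine Finset.sum_le_sum fun i _ => ?_
        split_ifs <;> simp_all
    _ ≤ 1 * H + 1 * H := by
        rw [Finset.sum_add_distrib, ← Finset.sum_filter, ← Finset.sum_filter, Finset.sum_const,
          Finset.sum_const, nsmul_eq_mul, nsmul_eq_mul]
        gcongr
        · exact_mod_cast h0
        · exact_mod_cast h1
    _ = 2 * H := by ring

end Ranks

/-! ### The mechanism -/

section MechanismDef

variable {A : Type*} [LinearOrder A] {m : ℕ}

/-- The share of the agent `i` on the machine `j` used by the agents of `T`, for given weights. -/
noncomputable def blockShare (c : Fin m → CostFn) (β : ℝ≥0∞) (w : Fin m → ℕ → ℝ≥0∞) (D : Finset A)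
    (j : Fin m) (T : Finset A) (i : A) : ℝ≥0∞ :=
  if i ∈ D then enfShare β (w j) (T ∩ D).card T.card (Mechanism.roleRank D T i)
  else regShare (c j) β (w j) (T ∩ D).card (T \ D).card T.card (Mechanism.roleRank D T i)

open Classical in
/-- The mechanism with the set `D` of enforcers. -/
noncomputable def enforcerMechanism [Fintype A] [Nonempty A] (D : Finset A) : Mechanism A where
  share c j T i := if h : Admissible A c then
    blockShare c h.exists_weighting.choose h.exists_weighting.choose_spec.choose D j T i else ∞

section BlockShare

variable {n : ℕ} {c : Fin m → CostFn} {β : ℝ≥0∞} {w : Fin m → ℕ → ℝ≥0∞} {D T : Finset A} {j : Fin m}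
  {i : A}

theorem blockShare_le (hW : Weighting c n β w) (hT : T.Nonempty) :
    blockShare c β w D j T i ≤ β * (4 * w j T.card) := by
  unfold blockShare
  split_ifs
  · exact enfShare_le (hW.block j) hT.card_pos
  · exact regShare_le (hW.cover j)

theorem blockShare_insert_enf (hi : i ∈ D) (hT : i ∉ T) :
    blockShare c β w D j (insert i T) i =
      enfShare β (w j) ((T ∩ D).card + 1) (T.card + 1) (Mechanism.roleRank D T i) := by
  rw [blockShare, if_pos hi, roleRank_insert, Finset.card_insert_of_notMem hT,
    Finset.insert_inter_of_mem hi, Finset.card_insert_of_notMem (by simp [hT])]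

theorem blockShare_insert_reg (hi : i ∉ D) (hT : i ∉ T) :
    blockShare c β w D j (insert i T) i =
      regShare (c j) β (w j) (T ∩ D).card ((T \ D).card + 1) (T.card + 1)
        (Mechanism.roleRank D T i) := by
  rw [blockShare, if_neg hi, roleRank_insert, Finset.card_insert_of_notMem hT,
    Finset.insert_inter_of_notMem hi, Finset.insert_sdiff_of_notMem _ hi,
    Finset.card_insert_of_notMem (by simp [hT])]

/-- One payer suffices. If a regular is present, the first one pays the cost or the default charge.
Otherwise there are either three enforcers, or a load of at most two, too far from a block end for
any discount. -/
theorem le_sum_blockShare (hW : Weighting c n β w) (hc0 : c j 0 = 0) :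
    c j T.card ≤ ∑ i ∈ T, blockShare c β w D j T i := by
  have hsingle : ∀ i ∈ T, blockShare c β w D j T i ≤ ∑ i ∈ T, blockShare c β w D j T i :=
    fun i hi => Finset.single_le_sum (fun _ _ => zero_le) hi
  have hcov : c j T.card ≤ β * (4 * w j T.card) :=
    (hW.cover j _).trans (by gcongr; exact le_mul_of_one_le_left zero_le (by norm_num))
  rcases (T \ D).eq_empty_or_nonempty with hb | hb
  · rcases T.eq_empty_or_nonempty with rfl | hT
    · simp [hc0]
    have hTD : T ∩ D = T := Finset.inter_eq_left.2 (Finset.sdiff_eq_empty_iff_subset.1 hb)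
    have hw := hW.block j
    obtain ⟨i, hi, hr⟩ := exists_rank_zero hT
    have hiD : i ∈ D := (Finset.mem_inter.1 (hTD.symm ▸ hi)).2
    refine hcov.trans (le_trans (le_of_eq ?_) (hsingle i hi))
    rw [blockShare, if_pos hiD, hTD]
    have hf : ∀ k, T.card ≤ 2 → k ≤ 1 → ¬ IsFull (w j) (T.card + k) := fun k _ _ h => by
      have := h.four_le hw; omega
    rcases lt_or_ge 2 T.card with h3 | h3
    · rw [enfShare_many h3]
    · have h0 := hf 0 h3 (by norm_num)
      have h1 := hf 1 h3 (by norm_num)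
      have h2 : ¬ IsFull (w j) (T.card - 1) := fun h => by have := h.four_le hw; omega
      have hpos := hT.card_pos
      generalize T.card = t at *
      interval_cases t
      · rw [enfShare_one_other h0 h2]
      · rw [enfShare_two_other h0 h1 h2]
  · obtain ⟨i, hi, hr⟩ := exists_rank_zero hb
    rw [Finset.mem_sdiff] at hi
    refine le_trans ?_ (hsingle i hi.1)
    rw [blockShare, if_neg hi.2, roleRank_of_notMem hi.2, hr, regShare, if_pos (Or.inl rfl)]
    split_ifs
    · exact le_rfl
    · exact hcov

end BlockShare

theorem pay_update {X : Mechanism A} {S : Finset A} {c : Fin m → CostFn} (s : Profile S m) (i : S)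
    (j : Fin m) :
    X.pay c (Function.update s i j) i = X.share c j (insert (i : A) (users s j)) i := by
  have : users (Function.update s i j) j = insert (i : A) (users s j) := by
    ext k
    simp only [mem_users, Finset.mem_insert]
    constructor
    · rintro ⟨hk, h⟩
      by_cases hki : (⟨k, hk⟩ : S) = i
      · exact Or.inl (congrArg Subtype.val hki)
      · rw [Function.update_of_ne hki] at h
        exact Or.inr ⟨hk, h⟩
    · rintro (rfl | ⟨hk, h⟩)
      · exact ⟨i.2, by simp⟩
      · refine ⟨hk, ?_⟩
        by_cases hki : (⟨k, hk⟩ : S) = i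
        · simp [hki]
        · rw [Function.update_of_ne hki, h]
  rw [Mechanism.pay, Function.update_self, this]

variable [Fintype A] [Nonempty A] {D : Finset A}

theorem enforcerMechanism_share {c : Fin m → CostFn} (h : Admissible A c) :
    ∃ β w, Weighting c (Fintype.card A) β w ∧
      ∀ j T i, (enforcerMechanism D).share c j T i = blockShare c β w D j T i :=
  ⟨_, _, h.exists_weighting.choose_spec.choose_spec, fun j T i => by simp [enforcerMechanism, h]⟩

theorem coversCosts_enforcerMechanism : (enforcerMechanism D).CoversCosts := by
  intro m c hc j T
  by_cases h : Admissible A c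
  · obtain ⟨β, w, hW, hs⟩ := enforcerMechanism_share (D := D) h
    simp only [hs]
    exact le_sum_blockShare hW (hc j).zero
  · rcases T.eq_empty_or_nonempty with rfl | ⟨i, hi⟩
    · simp [(hc j).zero]
    · have hi' := Finset.single_le_sum
        (f := fun i => (enforcerMechanism D).share c j T i) (fun _ _ => zero_le) hi
      simp only [enforcerMechanism, h, dite_false] at hi' ⊢
      exact le_top.trans hi'

theorem usesEnforcers_enforcerMechanism : (enforcerMechanism D).UsesEnforcers D := by
  intro m c j T T' i i' _ _ hD ha hb hr
  have hl : T.card = T'.card := by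
    rw [← Finset.card_inter_add_card_sdiff T D, ha, hb, Finset.card_inter_add_card_sdiff]
  by_cases h : Admissible A c
  · obtain ⟨β, w, hW, hs⟩ := enforcerMechanism_share (D := D) h
    simp only [hs, blockShare, ha, hb, hr, hl, hD]
  · simp [enforcerMechanism, h]

end MechanismDef

/-! ### Greedy fillings -/

section Greedy

variable {m n : ℕ} {c : Fin m → CostFn} {β : ℝ≥0∞} {w : Fin m → ℕ → ℝ≥0∞}

/-- Load vectors that fill the slots in the order of their weights. -/
def IsGreedy (w : Fin m → ℕ → ℝ≥0∞) (u : Fin m → ℕ) : Prop :=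
  ∀ j j', w j (u j) ≤ w j' (u j' + 1)

theorem exists_isGreedy [Nonempty (Fin m)] (hw : ∀ j, IsBlockWeight (w j)) (k : ℕ) :
    ∃ u : Fin m → ℕ, ∑ j, u j = k ∧ IsGreedy w u := by
  induction k with
  | zero => exact ⟨fun _ => 0, by simp, fun j j' => by simp [(hw j).zero]⟩
  | succ k ih =>
    obtain ⟨u, hu, hg⟩ := ih
    obtain ⟨j₁, hj₁⟩ := Finite.exists_min fun j => w j (u j + 1)
    have hle : ∀ j, w j (u j + 1) ≤ w j (Function.update u j₁ (u j₁ + 1) j + 1) := by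
      intro j
      apply (hw j).mono
      by_cases h : j = j₁
      · subst h; simp
      · simp [Function.update_of_ne h]
    refine ⟨Function.update u j₁ (u j₁ + 1), ?_, fun j j' => ?_⟩
    · rw [Finset.sum_update_of_mem (Finset.mem_univ _), ← hu,
        ← Finset.add_sum_erase _ _ (Finset.mem_univ j₁), Finset.sdiff_singleton_eq_erase]
      ring
    · refine le_trans ?_ (hle j')
      by_cases h : j = j₁
      · subst h
        simpa using hj₁ j'
      · rw [Function.update_of_ne h]
        exact hg j j'

/-- A vector of the same size as `u` either equals `u` or leaves one of its slots free. -/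
theorem IsGreedy.eq_or_exists_le (hw : ∀ j, IsBlockWeight (w j)) {u : Fin m → ℕ} {M : ℝ≥0∞}
    (hM : ∀ j, w j (u j) ≤ M) {v : Fin m → ℕ} (hv : ∑ j, v j = ∑ j, u j) :
    (∀ j, w j (v j) ≤ M) ∨ ∃ j, w j (v j + 1) ≤ M := by
  by_cases h : ∃ j, v j < u j
  · obtain ⟨j, hj⟩ := h
    exact Or.inr ⟨j, ((hw j).mono hj).trans (hM j)⟩
  · push Not at h
    have : ∀ j, u j = v j := fun j =>
      (Finset.sum_eq_sum_iff_of_le fun j _ => h j).1 hv.symm j (Finset.mem_univ j)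
    exact Or.inl fun j => this j ▸ hM j

theorem IsGreedy.le_optCost {A : Type*} {S : Finset A} (hW : Weighting c n β w)
    {u : Fin m → ℕ} (hg : IsGreedy w u) (hu : ∑ j, u j = S.card) (hS : S.card ≤ n) (j : Fin m) :
    β * w j (u j) ≤ 4 * optCost c S := by
  rw [optCost, ENNReal.mul_iInf_of_ne (by norm_num) (by norm_num)]
  refine le_iInf fun s => ?_
  exact (hW.greedy u (hu ▸ hS) hg j).2 _ ((sum_card_users s).trans hu.symm)

end Greedy

/-! ### Quality of equilibria -/

section Users

variable {A : Type*} {m : ℕ} {S : Finset A} {s : Profile S m}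

theorem sum_eq_sum_users (s : Profile S m) (g : Fin m → A → ℝ≥0∞) :
    ∑ i : S, g (s i) i = ∑ j, ∑ i ∈ users s j, g j i := by
  rw [← Finset.sum_fiberwise Finset.univ s]
  refine Finset.sum_congr rfl fun j _ => ?_
  rw [users, Finset.sum_map]
  refine Finset.sum_congr rfl fun i hi => ?_
  rw [(Finset.mem_filter.1 hi).2]
  rfl

theorem notMem_users_of_ne {j j' : Fin m} (h : j ≠ j') {i : A} (hi : i ∈ users s j) :
    i ∉ users s j' := by
  intro hi'
  obtain ⟨h1, h2⟩ := mem_users.1 hi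
  obtain ⟨_, h3⟩ := mem_users.1 hi'
  exact h (h2.symm.trans h3)

end Users

section Quality

variable {A : Type*} [LinearOrder A] {m n : ℕ} {c : Fin m → CostFn} {β : ℝ≥0∞}
  {w : Fin m → ℕ → ℝ≥0∞} {D S : Finset A} {X : Mechanism A} {s : Profile S m} {M : ℝ≥0∞}

theorem sum_card_users_inter (s : Profile S m) (D : Finset A) :
    ∑ j, (users s j ∩ D).card = (S ∩ D).card := by
  have h := sum_eq_sum_users s fun _ i => if i ∈ D then 1 else 0
  simp only [Finset.sum_boole, Finset.filter_mem_eq_inter] at h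
  have h2 : ∑ i : S, (if (i : A) ∈ D then (1 : ℝ≥0∞) else 0) = ((S ∩ D).card : ℝ≥0∞) := by
    rw [Finset.sum_coe_sort S fun i => if i ∈ D then (1 : ℝ≥0∞) else 0, Finset.sum_boole,
      Finset.filter_mem_eq_inter]
  rw [Finset.sum_boole] at h2
  rw [h2] at h
  exact_mod_cast h.symm

/-- Pure Nash equilibria in terms of the sets of users of the machines. -/
def UsersPNE (c : Fin m → CostFn) (β : ℝ≥0∞) (w : Fin m → ℕ → ℝ≥0∞) (D : Finset A)
    (s : Profile S m) : Prop :=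
  ∀ j, ∀ i ∈ users s j, ∀ j', j ≠ j' → blockShare c β w D j (users s j) i ≤
    blockShare c β w D j' (insert i (users s j')) i

theorem isPNE_iff_usersPNE (hX : ∀ j T i, X.share c j T i = blockShare c β w D j T i) :
    X.IsPNE c s ↔ UsersPNE c β w D s := by
  constructor
  · intro h j i hi j' _
    obtain ⟨hiS, rfl⟩ := mem_users.1 hi
    have := h ⟨i, hiS⟩ j'
    rwa [pay_update, Mechanism.pay, hX, hX] at this
  · intro h i j'
    rw [pay_update, Mechanism.pay, hX, hX]
    by_cases hj : s i = j'
    · subst hj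
      rw [Finset.insert_eq_self.2 (mem_users_self s i)]
    · exact h (s i) i (mem_users_self s i) j' hj

theorem UsersPNE.share_le (hW : Weighting c n β w) (hs : UsersPNE c β w D s)
    (hM : (∀ j, w j (users s j).card ≤ M) ∨ ∃ j, w j ((users s j).card + 1) ≤ M)
    {j : Fin m} {i : A} (hi : i ∈ users s j) :
    blockShare c β w D j (users s j) i ≤ β * (4 * M) := by
  have hle := blockShare_le (D := D) (j := j) (i := i) hW ⟨i, hi⟩
  rcases hM with hM | ⟨j', hM⟩
  · exact hle.trans (by gcongr; exact hM j)
  · by_cases h : j = j'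
    · subst h
      refine hle.trans ?_
      gcongr
      exact ((hW.block j).mono (Nat.le_succ _)).trans hM
    · refine (hs j i hi j' h).trans ((blockShare_le hW (Finset.insert_nonempty _ _)).trans ?_)
      rw [Finset.card_insert_of_notMem (notMem_users_of_ne h hi)]
      gcongr

theorem mul_four_le_cancel (hW : Weighting c n β w) {x y : ℝ≥0∞} (h : β * (4 * x) ≤ β * (4 * y)) :
    x ≤ y := by
  rw [ENNReal.mul_le_mul_iff_right hW.pos hW.fin] at h
  rwa [ENNReal.mul_le_mul_iff_right (by norm_num) (by norm_num)] at h

theorem exists_first_payer (c : Fin m → CostFn) (β : ℝ≥0∞) (w : Fin m → ℕ → ℝ≥0∞) (j : Fin m)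
    {T : Finset A} (hb : (T \ D).Nonempty) :
    ∃ i ∈ T, i ∉ D ∧ blockShare c β w D j T i =
      regShare (c j) β (w j) (T ∩ D).card (T \ D).card T.card 0 := by
  obtain ⟨i, hi, hr⟩ := exists_rank_zero hb
  rw [Finset.mem_sdiff] at hi
  exact ⟨i, hi.1, hi.2, by rw [blockShare, if_neg hi.2, roleRank_of_notMem hi.2, hr]⟩

theorem exists_first_enforcer (c : Fin m → CostFn) (β : ℝ≥0∞) (w : Fin m → ℕ → ℝ≥0∞) (j : Fin m)
    {T : Finset A} (ha : (T ∩ D).Nonempty) :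
    ∃ i ∈ T, i ∈ D ∧ blockShare c β w D j T i = enfShare β (w j) (T ∩ D).card T.card 0 := by
  obtain ⟨i, hi, hr⟩ := exists_rank_zero ha
  rw [Finset.mem_inter] at hi
  exact ⟨i, hi.1, hi.2, by rw [blockShare, if_pos hi.2, roleRank_of_mem hi.2, hr]⟩

/-- The first regular pays exactly the default charge here, so a bound on payments becomes a bound
on the weight. -/
theorem weight_le_of_heavy (hW : Weighting c n β w)
    (hpay : ∀ j, ∀ i ∈ users s j, blockShare c β w D j (users s j) i ≤ β * (4 * M)) {j : Fin m}
    (hb : (users s j \ D).Nonempty)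
    (hh : ¬ ((users s j ∩ D).card ≤ 1 ∧ IsFull (w j) (users s j).card)) :
    w j (users s j).card ≤ M := by
  obtain ⟨i, hi, -, hr⟩ := exists_first_payer c β w j hb
  have := hpay j i hi
  rw [hr, regShare_heavy (Or.inl rfl) hh] at this
  exact mul_four_le_cancel hW this

theorem not_four_mul_le (hW : Weighting c n β w) {x y : ℝ≥0∞} (hx : 1 ≤ x) (hy : 1 ≤ y) :
    ¬ β * (4 * x) ≤ β * (1 + y⁻¹) := by
  rw [ENNReal.mul_le_mul_iff_right hW.pos hW.fin, not_le]
  calc 1 + y⁻¹ ≤ 2 := one_add_inv_le_two hy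
    _ < 4 * 1 := by norm_num
    _ ≤ 4 * x := by gcongr

theorem le_of_attraction_le (hW : Weighting c n β w) {x y : ℝ≥0∞}
    (h : β * (1 + x⁻¹) ≤ β * (1 + y⁻¹)) : y ≤ x := by
  rw [ENNReal.mul_le_mul_iff_right hW.pos hW.fin, ENNReal.add_le_add_iff_left ENNReal.one_ne_top,
    ENNReal.inv_le_inv] at h
  exact h

theorem nonempty_sdiff_of_card_lt {T : Finset A} (h : (T ∩ D).card < T.card) : (T \ D).Nonempty := by
  rw [← Finset.card_pos]
  have := Finset.card_inter_add_card_sdiff T D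
  omega

/-- In an equilibrium with two enforcers or more, no full machine without enforcers has a weight
above `M`. -/
theorem UsersPNE.weight_le (hW : Weighting c n β w) (hs : UsersPNE c β w D s)
    (hpay : ∀ j, ∀ i ∈ users s j, blockShare c β w D j (users s j) i ≤ β * (4 * M))
    (hr : 2 ≤ (S ∩ D).card) {j₁ : Fin m} (ha₁ : users s j₁ ∩ D = ∅)
    (hf₁ : IsFull (w j₁) (users s j₁).card) : w j₁ (users s j₁).card ≤ M := by
  by_contra hlt
  rw [not_le] at hlt
  have hw₁ := (hW.block j₁).one_le _ hf₁.1
  -- Every enforcer could become the only enforcer on `j₁`, so none pays more than the attraction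
  -- price of that machine.
  have hatt : ∀ j, ∀ e ∈ users s j, e ∈ D → blockShare c β w D j (users s j) e ≤
      β * (1 + (w j₁ (users s j₁).card)⁻¹) := by
    intro j e he heD
    have hne : j ≠ j₁ := by
      rintro rfl
      exact absurd (Finset.mem_inter.2 ⟨he, heD⟩) (by simp [ha₁])
    have := hs j e he j₁ hne
    rwa [blockShare_insert_enf heD (notMem_users_of_ne hne he), ha₁, Finset.card_empty, zero_add,
      enfShare_one_over (hW.block j₁) hf₁] at this
  -- Default charges exceed this price, and so do the discounts at weights at most `M`, since `j₁`
  -- is heavier. Testing the first enforcer on each machine leaves only lone enforcers on full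
  -- machines.
  have hsingle : ∀ j, (users s j ∩ D).Nonempty →
      (users s j ∩ D).card = 1 ∧ IsFull (w j) (users s j).card := by
    intro j hne
    have hw := hW.block j
    obtain ⟨e, he, heD, hshare⟩ := exists_first_enforcer c β w j hne
    have hle := hatt j e he heD
    rw [hshare] at hle
    have hpos : 1 ≤ (users s j).card := Finset.card_pos.2 ⟨e, he⟩
    have hw1 := hw.one_le _ hpos
    have ha := hne.card_pos
    rcases lt_or_ge 2 (users s j ∩ D).card with h3 | h3
    · rw [enfShare_many h3] at hle
      exact absurd hle (not_four_mul_le hW hw1 hw₁)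
    rcases (by omega : (users s j ∩ D).card = 1 ∨ (users s j ∩ D).card = 2) with h1 | h2
    · refine ⟨h1, ?_⟩
      by_contra hnf
      rw [h1] at hle
      by_cases hov : IsFull (w j) ((users s j).card - 1)
      · have hl : (users s j).card = (users s j).card - 1 + 1 := by omega
        have h5 := hov.four_le hw
        have hb : (users s j \ D).Nonempty := nonempty_sdiff_of_card_lt (by omega)
        have hM := weight_le_of_heavy hW hpay hb fun h => hnf h.2
        rw [hl, enfShare_one_over hw hov] at hle
        have hge := le_of_attraction_le hW hle
        exact absurd (hlt.trans_le (hge.trans (hw.mono (Nat.sub_le _ 1)))) (not_lt.2 hM)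
      · rw [enfShare_one_other hnf hov] at hle
        exact not_four_mul_le hW hw1 hw₁ hle
    · exfalso
      rw [h2] at hle
      by_cases hfn : IsFull (w j) (users s j).card ∨ IsFull (w j) ((users s j).card + 1)
      · have h3 : 3 ≤ (users s j).card := by
          rcases hfn with h | h <;> have := h.four_le hw <;> omega
        have hb : (users s j \ D).Nonempty := nonempty_sdiff_of_card_lt (by omega)
        have hM := weight_le_of_heavy hW hpay hb fun h => by omega
        rw [enfShare_two_full hfn] at hle
        exact absurd (hlt.trans_le (le_of_attraction_le hW hle)) (not_lt.2 hM)
      · push Not at hfn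
        rw [enfShare_two_zero hfn.1 hfn.2] at hle
        exact not_four_mul_le hW hw1 hw₁ hle
  have hpair : ∀ x ∈ S ∩ D, ∀ y ∈ S ∩ D, ¬ x < y := by
    intro x hx y hy hxy
    rw [Finset.mem_inter] at hx hy
    have hxu := mem_users_self s ⟨x, hx.1⟩
    have hyu := mem_users_self s ⟨y, hy.1⟩
    set jx := s ⟨x, hx.1⟩
    set jy := s ⟨y, hy.1⟩
    have hxi : x ∈ users s jx ∩ D := Finset.mem_inter.2 ⟨hxu, hx.2⟩
    obtain ⟨hx1, hxf⟩ := hsingle jx ⟨x, hxi⟩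
    obtain ⟨hy1, hyf⟩ := hsingle jy ⟨y, Finset.mem_inter.2 ⟨hyu, hy.2⟩⟩
    obtain ⟨z, hz⟩ := Finset.card_eq_one.1 hx1
    have hzx : x = z := by simpa [hz] using hxi
    subst hzx
    have hne : jy ≠ jx := by
      intro h
      have : y ∈ users s jx ∩ D := Finset.mem_inter.2 ⟨h ▸ hyu, hy.2⟩
      rw [hz, Finset.mem_singleton] at this
      exact hxy.ne' this
    have := hs jy y hyu jx hne
    rw [blockShare_insert_enf hy.2 (notMem_users_of_ne hne hyu), roleRank_of_mem hy.2, hz,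
      Finset.filter_singleton, if_pos hxy, Finset.card_singleton,
      enfShare_two_over (hW.block jx) hxf, blockShare, if_pos hy.2, hy1,
      enfShare_one_full hyf] at this
    exact hW.pos (le_antisymm this zero_le)
  obtain ⟨x, hx, y, hy, hxy⟩ := Finset.one_lt_card.1 hr
  rcases lt_or_gt_of_ne hxy with h | h
  exacts [hpair x hx y hy h, hpair y hy x hx h]

/-- Joining a non-full used machine does not raise its weight. Equilibrium therefore forces equal
weights on two such machines, and finite weights do not tie. -/
theorem UsersPNE.eq_of_not_full (hW : Weighting c n β w) (hs : UsersPNE c β w D s)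
    (hpay : ∀ j, ∀ i ∈ users s j, blockShare c β w D j (users s j) i ≤ β * (4 * M))
    (hM : M ≠ ∞) {j₁ j₂ : Fin m} (h₁ : (users s j₁ \ D).Nonempty) (h₂ : (users s j₂ \ D).Nonempty)
    (hf₁ : ¬ IsFull (w j₁) (users s j₁).card) (hf₂ : ¬ IsFull (w j₂) (users s j₂).card) :
    j₁ = j₂ := by
  have key : ∀ j j' : Fin m, j ≠ j' → (users s j \ D).Nonempty → (users s j' \ D).Nonempty →
      ¬ IsFull (w j) (users s j).card → ¬ IsFull (w j') (users s j').card →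
      w j (users s j).card ≤ w j' (users s j').card := by
    intro j j' hne hj hj' hf hf'
    obtain ⟨i, hi, -, hr⟩ := exists_first_payer c β w j hj
    have := (hs j i hi j' hne).trans (blockShare_le hW (Finset.insert_nonempty _ _))
    rw [hr, regShare_heavy (Or.inl rfl) (fun h => hf h.2),
      Finset.card_insert_of_notMem (notMem_users_of_ne hne hi),
      (hW.block j').eq_succ (Finset.card_pos.2 (hj'.mono Finset.sdiff_subset)) hf'] at this
    exact mul_four_le_cancel hW this
  by_contra hne
  have heq := le_antisymm (key j₁ j₂ hne h₁ h₂ hf₁ hf₂) (key j₂ j₁ (Ne.symm hne) h₂ h₁ hf₂ hf₁)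
  have htop := hW.ne j₁ j₂ _ _ (Finset.card_pos.2 (h₁.mono Finset.sdiff_subset))
    (Finset.card_pos.2 (h₂.mono Finset.sdiff_subset)) hne heq
  have := weight_le_of_heavy hW hpay h₁ fun h => hf₁ h.2
  rw [htop] at this
  exact hM (top_le_iff.1 this)

theorem sum_reg_le (j : Fin m) (T : Finset A) :
    ∑ i ∈ T \ D, blockShare c β w D j T i ≤
      2 * regShare (c j) β (w j) (T ∩ D).card (T \ D).card T.card 0 := by
  refine le_trans (Finset.sum_le_sum fun i hi => ?_)
    (sum_first_last_le (T \ D) (regShare (c j) β (w j) (T ∩ D).card (T \ D).card T.card 0))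
  have hiD := (Finset.mem_sdiff.1 hi).2
  rw [blockShare, if_neg hiD, roleRank_of_notMem hiD]
  split_ifs with h
  · rw [regShare, if_pos h, regShare, if_pos (Or.inl rfl)]
  · rw [regShare, if_neg h]

theorem UsersPNE.sum_le (hW : Weighting c n β w) (hs : UsersPNE c β w D s)
    (hpay : ∀ j, ∀ i ∈ users s j, blockShare c β w D j (users s j) i ≤ β * (4 * M))
    (hM : M ≠ ∞) (hr : 2 ≤ (S ∩ D).card) :
    ∑ j, ∑ i ∈ users s j, blockShare c β w D j (users s j) i ≤
      (12 * (1 + (S ∩ D).card)) * (β * M) := by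
  classical
  set Z := Finset.univ.filter fun j =>
    (users s j \ D).Nonempty ∧ ¬ IsFull (w j) (users s j).card with hZ
  have hZ1 : Z.card ≤ 1 := by
    rw [Finset.card_le_one]
    intro j hj j' hj'
    simp only [hZ, Finset.mem_filter, Finset.mem_univ, true_and] at hj hj'
    exact hs.eq_of_not_full hW hpay hM hj.1 hj'.1 hj.2 hj'.2
  -- Machines with enforcers are charged to their enforcers; the others are non-full, hence in `Z`,
  -- or full and light. The factor two counts the first and last regular. Summing gives `4r + 2(4r +
  -- 4 + 2) = 12(1 + r)` for `r` enforcers.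
  have hmach : ∀ j, ∑ i ∈ users s j, blockShare c β w D j (users s j) i ≤
      (users s j ∩ D).card * (β * (4 * M)) + 2 * ((users s j ∩ D).card * (β * (4 * M)) +
        (if j ∈ Z then β * (4 * M) else 0) +
        if w j (users s j).card ≤ M then c j (users s j).card else 0) := by
    intro j
    rw [← Finset.sum_inter_add_sum_sdiff (users s j) D]
    refine add_le_add ?_ ?_
    · rw [← nsmul_eq_mul]
      exact Finset.sum_le_card_nsmul _ _ _ fun i hi => hpay j i (Finset.mem_inter.1 hi).1
    rcases (users s j \ D).eq_empty_or_nonempty with hb | hb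
    · simp [hb]
    refine (sum_reg_le j _).trans ?_
    gcongr
    obtain ⟨i, hi, hiD, hshare⟩ := exists_first_payer c β w j hb
    have h1 := hpay j i hi
    rw [hshare] at h1
    rcases Nat.eq_zero_or_pos (users s j ∩ D).card with ha | ha
    · by_cases hf : IsFull (w j) (users s j).card
      · have := hs.weight_le hW hpay hr (Finset.card_eq_zero.1 ha) hf
        rw [if_pos this, regShare_light (Or.inl rfl) (by omega) hf]
        exact le_add_self
      · have : j ∈ Z := by simp [hZ, hb, hf]
        rw [if_pos this]
        exact h1.trans (le_add_self.trans le_self_add)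
    · refine h1.trans (le_trans ?_ (le_self_add.trans le_self_add))
      exact le_mul_of_one_le_left zero_le (by exact_mod_cast ha)
  have hA : ∑ j, ((users s j ∩ D).card : ℝ≥0∞) = (S ∩ D).card := by
    exact_mod_cast sum_card_users_inter s D
  calc _ ≤ _ := Finset.sum_le_sum fun j _ => hmach j
    _ = (S ∩ D).card * (β * (4 * M)) + 2 * ((S ∩ D).card * (β * (4 * M)) +
        Z.card * (β * (4 * M)) +
        ∑ j with w j (users s j).card ≤ M, c j (users s j).card) := by
      rw [Finset.sum_add_distrib, ← Finset.mul_sum, Finset.sum_add_distrib, Finset.sum_add_distrib,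
        ← Finset.sum_mul, hA, Finset.sum_ite_mem, Finset.univ_inter, Finset.sum_const, nsmul_eq_mul,
        Finset.sum_filter]
    _ ≤ (S ∩ D).card * (β * (4 * M)) + 2 * ((S ∩ D).card * (β * (4 * M)) +
        1 * (β * (4 * M)) + β * (2 * M)) := by
      gcongr
      · exact_mod_cast hZ1
      · exact hW.light_sum _ M
    _ = _ := by ring

theorem socialCost_eq (hX : ∀ j T i, X.share c j T i = blockShare c β w D j T i) :
    X.socialCost c s = ∑ j, ∑ i ∈ users s j, blockShare c β w D j (users s j) i := by
  rw [← sum_eq_sum_users s fun j i => blockShare c β w D j (users s j) i, Mechanism.socialCost]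
  simp only [Mechanism.pay, hX]

/-- The bound on the price of anarchy of a single game. -/
noncomputable def poaBound (D S : Finset A) : ℝ≥0∞ :=
  if 2 ≤ (S ∩ D).card then 48 * (1 + (S ∩ D).card) else 16 * S.card

theorem PoA_le_poaBound (hW : Weighting c n β w)
    (hX : ∀ j T i, X.share c j T i = blockShare c β w D j T i) (hS : S.card ≤ n) :
    X.PoA c S ≤ poaBound D S := by
  refine ENNReal.div_le_of_le_mul (iSup_le fun s => iSup_le fun hs => ?_)
  rcases S.eq_empty_or_nonempty with rfl | ⟨i₀, hi₀⟩
  · simp [Mechanism.socialCost]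
  have : Nonempty (Fin m) := ⟨s ⟨i₀, hi₀⟩⟩
  rw [isPNE_iff_usersPNE hX] at hs
  rw [socialCost_eq hX]
  obtain ⟨u, hu, hg⟩ := exists_isGreedy hW.block S.card
  obtain ⟨j₁, hj₁⟩ := Finite.exists_max fun j => w j (u j)
  set M := w j₁ (u j₁)
  have hMopt : β * M ≤ 4 * optCost c S := hg.le_optCost hW hu hS j₁
  have hMfin : M ≠ ∞ := (hW.greedy u (hu ▸ hS) hg j₁).1
  have hpay : ∀ j, ∀ i ∈ users s j, blockShare c β w D j (users s j) i ≤ β * (4 * M) :=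
    fun j i hi => hs.share_le hW
      (IsGreedy.eq_or_exists_le hW.block hj₁ ((sum_card_users s).trans hu.symm)) hi
  unfold poaBound
  split_ifs with hr
  · calc _ ≤ (12 * (1 + (S ∩ D).card)) * (β * M) := hs.sum_le hW hpay hMfin hr
      _ ≤ (12 * (1 + (S ∩ D).card)) * (4 * optCost c S) := by gcongr
      _ = _ := by ring
  · calc ∑ j, ∑ i ∈ users s j, blockShare c β w D j (users s j) i
        ≤ ∑ j, (users s j).card * (β * (4 * M)) := by
          refine Finset.sum_le_sum fun j _ => ?_
          rw [← nsmul_eq_mul]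
          exact Finset.sum_le_card_nsmul _ _ _ (hpay j)
      _ = S.card * (4 * (β * M)) := by
          rw [← Finset.sum_mul, ← Nat.cast_sum, sum_card_users]
          ring
      _ ≤ S.card * (4 * (4 * optCost c S)) := by gcongr
      _ = _ := by ring

end Quality

/-! ### Assignments with prescribed loads -/

section Assignments

variable {A : Type*} [LinearOrder A] {m : ℕ}

theorem exists_monotone_assignment [Nonempty (Fin m)] (R : Finset A) :
    ∀ b : Fin m → ℕ, ∑ j, b j = R.card →
      ∃ g : A → Fin m, (∀ x ∈ R, ∀ y ∈ R, x ≤ y → g x ≤ g y) ∧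
        ∀ j, (R.filter fun i => g i = j).card = b j := by
  classical
  induction R using Finset.induction_on_max with
  | empty =>
    intro b hb
    have hb0 : ∀ j, b j = 0 := by simpa using hb
    exact ⟨fun _ => Classical.arbitrary _, by simp, by simp [hb0]⟩
  | insert x R hx ih =>
    intro b hb
    have hxR : x ∉ R := fun h => (hx x h).false
    rw [Finset.card_insert_of_notMem hxR] at hb
    have hF : (Finset.univ.filter fun j => 1 ≤ b j).Nonempty := by
      by_contra h
      rw [Finset.not_nonempty_iff_eq_empty, Finset.filter_eq_empty_iff] at h
      have : ∑ j, b j = 0 := Finset.sum_eq_zero fun j hj => by have := h hj; omega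
      omega
    set j₁ := (Finset.univ.filter fun j => 1 ≤ b j).max' hF
    have hj₁ : 1 ≤ b j₁ := (Finset.mem_filter.1 (Finset.max'_mem _ hF)).2
    have hmax : ∀ j, 1 ≤ b j → j ≤ j₁ := fun j hj => Finset.le_max' _ _ (by simpa using hj)
    obtain ⟨g, hg, hgb⟩ := ih (Function.update b j₁ (b j₁ - 1)) (by
      have h1 := Finset.add_sum_erase Finset.univ b (Finset.mem_univ j₁)
      rw [Finset.sum_update_of_mem (Finset.mem_univ _), Finset.sdiff_singleton_eq_erase]
      omega)
    have hle : ∀ y ∈ R, g y ≤ j₁ := by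
      intro y hy
      apply hmax
      have h1 : 1 ≤ (R.filter fun i => g i = g y).card :=
        Finset.card_pos.2 ⟨y, by simp [hy]⟩
      rw [hgb] at h1
      by_cases h : g y = j₁
      · rw [h]; exact hj₁
      · rwa [Function.update_of_ne h] at h1
    refine ⟨Function.update g x j₁, ?_, fun j => ?_⟩
    · intro y hy z hz hyz
      rcases Finset.mem_insert.1 hy with rfl | hy'
      · rcases Finset.mem_insert.1 hz with rfl | hz'
        · exact le_rfl
        · exact absurd (hx z hz') (not_lt.2 hyz)
      · rw [Function.update_of_ne (hx y hy').ne]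
        rcases Finset.mem_insert.1 hz with rfl | hz'
        · rw [Function.update_self]
          exact hle y hy'
        · rw [Function.update_of_ne (hx z hz').ne]
          exact hg y hy' z hz' hyz
    · have hcongr : (R.filter fun i => Function.update g x j₁ i = j) = R.filter fun i => g i = j :=
        Finset.filter_congr fun i hi => by rw [Function.update_of_ne (hx i hi).ne]
      rw [Finset.filter_insert, Function.update_self, hcongr]
      by_cases h : j₁ = j
      · subst h
        rw [if_pos rfl, Finset.card_insert_of_notMem (by simp [hxR]), hgb, Function.update_self]
        omega
      · rw [if_neg h, hgb, Function.update_of_ne (Ne.symm h)]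

/-- Reserving the largest element of `R` for `j₁` gives every other element rank zero when it joins
`j₁`. -/
theorem exists_assignment_last {R : Finset A} {a : Fin m → ℕ} (ha : ∑ j, a j = R.card) {j₁ : Fin m}
    (hj₁ : a j₁ = 1) :
    ∃ f : A → Fin m, (∀ j, (R.filter fun i => f i = j).card = a j) ∧
      ∀ y ∈ R, f y = j₁ → ∀ x ∈ R, x ≤ y := by
  classical
  have hsum := Finset.add_sum_erase Finset.univ a (Finset.mem_univ j₁)
  have hR : R.Nonempty := Finset.card_pos.1 (by omega)
  have : Nonempty (Fin m) := ⟨j₁⟩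
  obtain ⟨z, hz, hzmax⟩ : ∃ z ∈ R, ∀ x ∈ R, x ≤ z := ⟨_, R.max'_mem hR, fun x hx => R.le_max' x hx⟩
  obtain ⟨g, -, hg⟩ := exists_monotone_assignment (R.erase z)
    (Function.update a j₁ 0) (by
      rw [Finset.sum_update_of_mem (Finset.mem_univ _), Finset.sdiff_singleton_eq_erase,
        Finset.card_erase_of_mem hz]
      omega)
  have hne : ∀ y ∈ R.erase z, g y ≠ j₁ := by
    intro y hy h
    have h1 := hg j₁
    rw [Function.update_self, Finset.card_eq_zero, Finset.filter_eq_empty_iff] at h1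
    exact h1 hy h
  refine ⟨Function.update g z j₁, fun j => ?_, fun y hy hyj x hx => ?_⟩
  · have hcongr : ((R.erase z).filter fun i => Function.update g z j₁ i = j) =
        (R.erase z).filter fun i => g i = j :=
      Finset.filter_congr fun i hi => by rw [Function.update_of_ne (Finset.ne_of_mem_erase hi)]
    conv_lhs => rw [← Finset.insert_erase hz]
    rw [Finset.filter_insert, Function.update_self, hcongr]
    by_cases h : j₁ = j
    · subst h
      rw [if_pos rfl, Finset.card_insert_of_notMem (by simp), hg, Function.update_self, hj₁]
    · rw [if_neg h, hg, Function.update_of_ne (Ne.symm h)]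
  · by_contra hlt
    have hym : y ≠ z := fun h => hlt (h ▸ hzmax x hx)
    rw [Function.update_of_ne hym] at hyj
    exact hne y (Finset.mem_erase.2 ⟨hym, hy⟩) hyj

theorem exists_between {ι : Type*} [Fintype ι] {lo hi : ι → ℕ} {r : ℕ} (hlh : ∀ j, lo j ≤ hi j)
    (hlo : ∑ j, lo j ≤ r) (hhi : r ≤ ∑ j, hi j) :
    ∃ a : ι → ℕ, (∀ j, lo j ≤ a j) ∧ (∀ j, a j ≤ hi j) ∧ ∑ j, a j = r := by
  classical
  induction r with
  | zero => exact ⟨lo, fun _ => le_rfl, hlh, Nat.le_zero.1 hlo⟩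
  | succ r ih =>
    rcases hlo.eq_or_lt with h | h
    · exact ⟨lo, fun _ => le_rfl, hlh, h⟩
    obtain ⟨a, h1, h2, h3⟩ := ih (by omega) (by omega)
    have : ∃ j, a j < hi j := by
      by_contra! hall
      have := Finset.sum_le_sum fun j (_ : j ∈ Finset.univ) => hall j
      omega
    obtain ⟨j₁, hj₁⟩ := this
    refine ⟨Function.update a j₁ (a j₁ + 1), fun j => ?_, fun j => ?_, ?_⟩
    · by_cases h : j = j₁
      · subst h; rw [Function.update_self]; have := h1 j; omega
      · rw [Function.update_of_ne h]; exact h1 j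
    · by_cases h : j = j₁
      · subst h; rw [Function.update_self]; omega
      · rw [Function.update_of_ne h]; exact h2 j
    · have := Finset.add_sum_erase Finset.univ a (Finset.mem_univ j₁)
      rw [Finset.sum_update_of_mem (Finset.mem_univ _), Finset.sdiff_singleton_eq_erase]
      omega

theorem exists_top_subset {ι α : Type*} [LinearOrder α] (C : Finset ι) (f : ι → α) {k : ℕ}
    (hk : k ≤ C.card) :
    ∃ P ⊆ C, P.card = k ∧ ∀ j ∈ P, ∀ j' ∈ C, j' ∉ P → f j' ≤ f j := by
  classical
  induction k with
  | zero => exact ⟨∅, by simp, by simp, by simp⟩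
  | succ k ih =>
    obtain ⟨P, hP, hPc, hPt⟩ := ih (by omega)
    have hne : (C \ P).Nonempty := by
      rw [← Finset.card_pos, Finset.card_sdiff_of_subset hP]
      omega
    obtain ⟨j₁, hj₁, hmax⟩ := (C \ P).exists_max_image f hne
    rw [Finset.mem_sdiff] at hj₁
    refine ⟨insert j₁ P, Finset.insert_subset hj₁.1 hP, ?_, ?_⟩
    · rw [Finset.card_insert_of_notMem hj₁.2, hPc]
    · intro j hj j' hj' hj'P
      rw [Finset.mem_insert, not_or] at hj'P
      rcases Finset.mem_insert.1 hj with rfl | hj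
      · exact hmax j' (Finset.mem_sdiff.2 ⟨hj', hj'P.2⟩)
      · exact hPt j hj j' hj' hj'P.2

end Assignments

/-! ### Equilibrium profiles on fillings -/

section Profiles

variable {A : Type*} [LinearOrder A] {m n : ℕ} {c : Fin m → CostFn} {β : ℝ≥0∞}
  {w : Fin m → ℕ → ℝ≥0∞} {D S : Finset A} {s : Profile S m} {M : ℝ≥0∞}

/-- The regular agents on machines of larger index come later in the priority order. -/
def RegularsSorted (D : Finset A) (s : Profile S m) : Prop :=
  ∀ j j', j < j' → ∀ x ∈ users s j, ∀ y ∈ users s j', x ∉ D → y ∉ D → x < y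

theorem exists_profile [Nonempty (Fin m)] {a b : Fin m → ℕ} (hb : ∑ j, b j = (S \ D).card) {f : A → Fin m}
    (hf : ∀ j, ((S ∩ D).filter fun i => f i = j).card = a j) :
    ∃ s : Profile S m, RegularsSorted D s ∧ (∀ i (h : i ∈ S), i ∈ D → s ⟨i, h⟩ = f i) ∧
      ∀ j, (users s j ∩ D).card = a j ∧ (users s j).card = a j + b j := by
  obtain ⟨g, hg, hgb⟩ := exists_monotone_assignment (S \ D) b hb
  let s : Profile S m := fun i => if (i : A) ∈ D then f i else g i
  have hreg : ∀ j x, x ∈ users s j → x ∉ D → x ∈ S \ D ∧ g x = j := by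
    intro j x hx hxD
    obtain ⟨hxS, h⟩ := mem_users.1 hx
    exact ⟨Finset.mem_sdiff.2 ⟨hxS, hxD⟩, by simpa [s, hxD] using h⟩
  have h1 : ∀ j, (users s j ∩ D).card = a j := by
    intro j
    rw [← hf]
    congr 1
    ext i
    simp only [Finset.mem_inter, mem_users, Finset.mem_filter, s]
    constructor
    · rintro ⟨⟨hi, h⟩, hD⟩
      exact ⟨⟨hi, hD⟩, by simpa [hD] using h⟩
    · rintro ⟨⟨hi, hD⟩, h⟩
      exact ⟨⟨hi, by simpa [hD] using h⟩, hD⟩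
  have h2 : ∀ j, (users s j \ D).card = b j := by
    intro j
    rw [← hgb]
    congr 1
    ext i
    simp only [Finset.mem_sdiff, mem_users, Finset.mem_filter, s]
    constructor
    · rintro ⟨⟨hi, h⟩, hD⟩
      exact ⟨⟨hi, hD⟩, by simpa [hD] using h⟩
    · rintro ⟨⟨hi, hD⟩, h⟩
      exact ⟨⟨hi, by simpa [hD] using h⟩, hD⟩
  refine ⟨s, ?_, fun i h hD => by simp [s, hD], fun j => ⟨h1 j, ?_⟩⟩
  · intro j j' hjj x hx y hy hxD hyD
    obtain ⟨hx1, rfl⟩ := hreg j x hx hxD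
    obtain ⟨hy1, rfl⟩ := hreg j' y hy hyD
    by_contra hlt
    exact absurd (hg y hy1 x hx1 (not_lt.1 hlt)) (not_le.2 hjj)
  · rw [← Finset.card_inter_add_card_sdiff (users s j) D, h1, h2]

-- Sorting makes a newcomer the first or the last regular on its new machine, so it cannot escape
-- payment. This is why both ends of the priority order pay.
open Classical in
theorem RegularsSorted.blockShare_insert (hs : RegularsSorted D s) {j j' : Fin m} (hne : j ≠ j')
    {i : A} (hi : i ∈ users s j) (hiD : i ∉ D) :
    blockShare c β w D j' (insert i (users s j')) i =
      if (users s j' ∩ D).card ≤ 1 ∧ IsFull (w j') ((users s j').card + 1) then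
        c j' ((users s j').card + 1) else β * (4 * w j' ((users s j').card + 1)) := by
  rw [blockShare_insert_reg hiD (notMem_users_of_ne hne hi), regShare, if_pos]
  rw [roleRank_of_notMem hiD]
  rcases lt_or_gt_of_ne hne with h | h
  · left
    rw [Finset.card_eq_zero, Finset.filter_eq_empty_iff]
    intro k hk
    rw [Finset.mem_sdiff] at hk
    exact not_lt.2 (hs j j' h i hi k hk.1 hiD hk.2).le
  · right
    rw [Finset.filter_true_of_mem]
    intro k hk
    rw [Finset.mem_sdiff] at hk
    exact hs j' j h k hk.1 i hi hk.2 hiD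

theorem blockShare_le_of_weight_le (hW : Weighting c n β w)
    (hle : ∀ j, w j (users s j).card ≤ M) {j : Fin m} {i : A} (hi : i ∈ users s j) :
    blockShare c β w D j (users s j) i ≤ β * (4 * M) := by
  refine (blockShare_le hW ⟨i, hi⟩).trans ?_
  gcongr
  exact hle j

/-- A regular newcomer faces a default charge of at least `4βM` unless it completes a block in the
presence of at most one enforcer, which `hfull` excludes. Only deviations of enforcers remain. -/
theorem usersPNE_of_sorted (hW : Weighting c n β w) (hsort : RegularsSorted D s)
    (hle : ∀ j, w j (users s j).card ≤ M) (hge : ∀ j, M ≤ w j ((users s j).card + 1))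
    (hfull : ∀ j, IsFull (w j) ((users s j).card + 1) → 2 ≤ (users s j ∩ D).card)
    (henf : ∀ j, ∀ i ∈ users s j, i ∈ D → ∀ j', j ≠ j' → blockShare c β w D j (users s j) i ≤
      enfShare β (w j') ((users s j' ∩ D).card + 1) ((users s j').card + 1)
        (Mechanism.roleRank D (users s j') i)) : UsersPNE c β w D s := by
  intro j i hi j' hne
  by_cases hiD : i ∈ D
  · rw [blockShare_insert_enf hiD (notMem_users_of_ne hne hi)]
    exact henf j i hi hiD j' hne
  · rw [hsort.blockShare_insert hne hi hiD, if_neg]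
    · refine (blockShare_le_of_weight_le hW hle hi).trans ?_
      gcongr
      exact hge j'
    · rintro ⟨h1, h2⟩
      have := hfull j' h2
      omega

/-- Filling the slots in the order of their weights leaves at most one machine in the middle of
a block, the one with the largest weight. -/
structure IsFilling (w : Fin m → ℕ → ℝ≥0∞) (M : ℝ≥0∞) (t : Fin m) (u : Fin m → ℕ) : Prop where
  top : w t (u t) = M
  pos : 1 ≤ u t
  le : ∀ j, w j (u j) ≤ M
  ge : ∀ j, M ≤ w j (u j + 1)
  lt : ∀ j, j ≠ t → w j (u j) < M
  full : ∀ j, j ≠ t → 1 ≤ u j → IsFull (w j) (u j)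

theorem exists_isFilling [Nonempty (Fin m)] (hW : Weighting c n β w) {k : ℕ} (hk : 1 ≤ k)
    (hkn : k ≤ n) : ∃ M t u, ∑ j, u j = k ∧ IsFilling w M t u := by
  obtain ⟨u, hu, hg⟩ := exists_isGreedy hW.block k
  obtain ⟨t, ht⟩ := Finite.exists_max fun j => w j (u j)
  have hfin : w t (u t) ≠ ∞ := (hW.greedy u (hu ▸ hkn) hg t).1
  have hpos : 1 ≤ u t := by
    by_contra h
    have h0 : u t = 0 := by omega
    have : ∑ j, u j = 0 := by
      refine Finset.sum_eq_zero fun j _ => ?_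
      by_contra hj
      have h1 := ht j
      rw [h0, (hW.block t).zero] at h1
      exact absurd ((hW.block j).one_le (u j) (by omega)) (not_le.2 (h1.trans_lt one_pos))
    omega
  have hlt : ∀ j, j ≠ t → w j (u j) < w t (u t) := by
    intro j hj
    refine lt_of_le_of_ne (ht j) fun h => ?_
    rcases Nat.eq_zero_or_pos (u j) with h0 | h0
    · have := (hW.block t).one_le _ hpos
      rw [← h, h0, (hW.block j).zero] at this
      simp at this
    · exact hfin (h ▸ hW.ne j t _ _ h0 hpos hj h)
  exact ⟨w t (u t), t, u, hu, rfl, hpos, ht, hg t, hlt,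
    fun j hj hj1 => ⟨hj1, (hlt j hj).trans_le (hg t j)⟩⟩

section Existence

variable {t : Fin m} {u : Fin m → ℕ}

theorem not_isFull_of_le {w : ℕ → ℝ≥0∞} (hw : IsBlockWeight w) {l : ℕ} (hl : l ≤ 3) : ¬ IsFull w l :=
  fun h => by have := h.four_le hw; omega

/-- A deviator would be alone on an empty machine, far from a block end, and pay the default charge
of a slot of weight at least `M`. -/
theorem exists_pne_single (hW : Weighting c n β w) (hu : ∑ j, u j = S.card)
    (hF : IsFilling w M t u) (h0 : ∀ j, j ≠ t → u j = 0) : ∃ s : Profile S m, UsersPNE c β w D s := by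
  have hut : u t = S.card := by
    rw [← hu, Finset.sum_eq_single t (fun j _ hj => h0 j hj) (by simp)]
  have hall : ∀ j, j ≠ t → users (fun _ : S => t) j = ∅ := by
    intro j hj
    ext i
    simp [mem_users, Ne.symm hj]
  have ht : users (fun _ : S => t) t = S := by
    ext i
    simp [mem_users]
  refine ⟨fun _ => t, fun j i hi j' hne => ?_⟩
  have hj : j = t := by
    obtain ⟨_, h⟩ := mem_users.1 hi
    exact h.symm
  subst hj
  rw [hall j' (Ne.symm hne)]
  have hw' := hW.block j'
  have h1 : β * (4 * M) ≤ β * (4 * w j' 1) := by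
    gcongr
    simpa [h0 j' (Ne.symm hne)] using hF.ge j'
  refine (blockShare_le hW ⟨i, hi⟩).trans (le_trans ?_ (h1.trans (le_of_eq ?_)))
  · rw [ht, ← hut, hF.top]
  · by_cases hiD : i ∈ D
    · rw [blockShare_insert_enf hiD (by simp)]
      simp [enfShare_one_other (not_isFull_of_le hw' (l := 1) (by norm_num))
        (not_isFull_of_le hw' (l := 1 - 1) (by norm_num))]
    · rw [blockShare_insert_reg hiD (by simp)]
      simp [Mechanism.roleRank,
        regShare_heavy (Or.inl rfl) (fun h => not_isFull_of_le hw' (l := 1) (by norm_num) h.2)]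

/-- A regular could complete the block of `t` at true cost. So that slot is filled, making every
used machine full, and the vacancy is moved to the used machine `v` of largest cost, where
completing the block costs a regular at least its present share. The enforcer, if any, pays `β` on
another full machine and would pay `β` on `v` too. -/
theorem exists_pne_vacancy (hW : Weighting c n β w) (hu : ∑ j, u j = S.card)
    (hF : IsFilling w M t u) (hnear : IsFull (w t) (u t + 1)) (hr : (S ∩ D).card ≤ 1)
    {j₂ : Fin m} (hj₂ : j₂ ≠ t) (hu₂ : 1 ≤ u j₂) : ∃ s : Profile S m, UsersPNE c β w D s := by
  classical
  set u' := Function.update u t (u t + 1) with hu'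
  have hu't : u' t = u t + 1 := by simp [hu']
  have hu'ne : ∀ j, j ≠ t → u' j = u j := fun j hj => by simp [hu', hj]
  have hfull : ∀ j, 1 ≤ u' j → IsFull (w j) (u' j) := by
    intro j hj
    by_cases h : j = t
    · subst h; rwa [hu't]
    · rw [hu'ne j h] at hj ⊢; exact hF.full j h hj
  have hnf : ¬ IsFull (w t) (u t) := fun h =>
    h.not_add (hW.block t) le_rfl (by norm_num) hnear
  have hle : ∀ j, w j (u' j) ≤ M := by
    intro j
    by_cases h : j = t
    · subst h; rw [hu't, (hW.block j).eq_succ hF.pos hnf, hF.top]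
    · rw [hu'ne j h]; exact hF.le j
  have hge : ∀ j, M ≤ w j (u' j + 1) := by
    intro j
    by_cases h : j = t
    · subst h; rw [hu't]; exact (hF.ge j).trans ((hW.block j).mono (by omega))
    · rw [hu'ne j h]; exact hF.ge j
  have hsum' : ∑ j, u' j = S.card + 1 := by
    have := Finset.add_sum_erase Finset.univ u (Finset.mem_univ t)
    rw [hu', Finset.sum_update_of_mem (Finset.mem_univ _), Finset.sdiff_singleton_eq_erase]
    omega
  obtain ⟨v, hv, hvmax⟩ := (Finset.univ.filter fun j => 1 ≤ u' j).exists_max_image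
    (fun j => c j (u' j)) ⟨t, by simp [hu't]⟩
  replace hv : 1 ≤ u' v := by simpa using hv
  have hvmax' : ∀ j, 1 ≤ u' j → c j (u' j) ≤ c v (u' v) := fun j hj => hvmax j (by simpa using hj)
  have hv4 := (hfull v hv).four_le (hW.block v)
  obtain ⟨x, hxv, hx⟩ : ∃ x, x ≠ v ∧ 1 ≤ u' x := by
    by_cases h : v = t
    · exact ⟨j₂, h ▸ hj₂, by rw [hu'ne j₂ hj₂]; exact hu₂⟩
    · exact ⟨t, Ne.symm h, by omega⟩
  set l := Function.update u' v (u' v - 1) with hl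
  have hlv : l v + 1 = u' v := by simp [hl]; omega
  have hlne : ∀ j, j ≠ v → l j = u' j := fun j hj => by simp [hl, hj]
  have hlsum : ∑ j, l j = S.card := by
    have := Finset.add_sum_erase Finset.univ u' (Finset.mem_univ v)
    rw [hl, Finset.sum_update_of_mem (Finset.mem_univ _), Finset.sdiff_singleton_eq_erase]
    omega
  have hx4 := (hfull x hx).four_le (hW.block x)
  set a : Fin m → ℕ := fun j => if j = x then (S ∩ D).card else 0 with ha
  have hal : ∀ j, a j ≤ l j := by
    intro j
    by_cases h : j = x
    · subst h; simp only [ha, if_true, hlne j hxv]; omega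
    · simp [ha, h]
  have hasum : ∑ j, a j = (S ∩ D).card := by simp [ha]
  have ha1 : ∀ j, a j ≤ 1 := fun j => by simp only [ha]; split_ifs <;> omega
  have : Nonempty (Fin m) := ⟨t⟩
  obtain ⟨f, -, hf⟩ := exists_monotone_assignment (S ∩ D) a hasum
  obtain ⟨s, hsort, -, hcard⟩ := exists_profile (b := fun j => l j - a j) (D := D) (S := S) (by
    rw [Finset.sum_tsub_distrib _ (fun j _ => hal j), hlsum, hasum]
    have := Finset.card_inter_add_card_sdiff S D
    omega) hf
  have hcu : ∀ j, (users s j).card = l j := fun j => by rw [(hcard j).2]; have := hal j; omega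
  have hca : ∀ j, (users s j ∩ D).card = a j := fun j => (hcard j).1
  have hlw : ∀ j, w j (users s j).card ≤ M := by
    intro j
    rw [hcu]
    by_cases h : j = v
    · subst h; exact ((hW.block j).mono (by omega)).trans (hle j)
    · rw [hlne j h]; exact hle j
  have hnext : ∀ j, j ≠ v → ¬ IsFull (w j) (l j + 1) := by
    intro j hj
    rw [hlne j hj]
    rcases Nat.eq_zero_or_pos (u' j) with h0 | h0
    · rw [h0]; exact not_isFull_of_le (hW.block j) (by norm_num)
    · exact (hfull j h0).not_add (hW.block j) le_rfl (by norm_num)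
  refine ⟨s, fun j i hi j' hne => ?_⟩
  have hlj : 1 ≤ l j := by rw [← hcu]; exact Finset.card_pos.2 ⟨i, hi⟩
  by_cases hiD : i ∈ D
  · have haj : 1 ≤ a j := by
      rw [← hca]; exact Finset.card_pos.2 ⟨i, Finset.mem_inter.2 ⟨hi, hiD⟩⟩
    have hjx : j = x := by
      by_contra h
      simp [ha, h] at haj
    subst hjx
    have haj1 : a j = 1 := le_antisymm (ha1 j) haj
    rw [blockShare_insert_enf hiD (notMem_users_of_ne hne hi), blockShare, if_pos hiD, hca, hca, hcu,
      hcu, haj1, hlne j hxv, enfShare_one_full (hfull j hx)]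
    have haj' : a j' = 0 := by simp [ha, Ne.symm hne]
    rw [haj', zero_add]
    by_cases hj' : j' = v
    · subst hj'
      rw [hlv, enfShare_one_full (hfull j' hv)]
    · rcases Nat.eq_zero_or_pos (u' j') with h0 | h0
      · rw [hlne j' hj', h0, enfShare_one_other (not_isFull_of_le (hW.block j') (by norm_num))
          (not_isFull_of_le (hW.block j') (by norm_num))]
        refine le_mul_of_one_le_right zero_le ?_
        exact (by norm_num : (1 : ℝ≥0∞) ≤ 2).trans
          (two_le_four_mul ((hW.block j').one_le _ (by norm_num)))
      · rw [hlne j' hj', enfShare_one_over (hW.block j') (hfull j' h0)]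
        exact le_mul_of_one_le_right zero_le le_self_add
  · rw [hsort.blockShare_insert hne hi hiD, hca, hcu]
    by_cases hj' : j' = v
    · subst hj'
      rw [hlv, if_pos ⟨ha1 j', hfull j' hv⟩]
      have huj : 1 ≤ u' j := by rwa [← hlne j hne]
      refine le_trans ?_ (hvmax' j huj)
      rw [blockShare, if_neg hiD, hca, hcu, hlne j hne, regShare]
      split_ifs with _ h
      · exact le_rfl
      · exact absurd ⟨ha1 j, hfull j huj⟩ h
      · exact zero_le
    · rw [if_neg fun h => hnext j' hj' h.2]
      refine (blockShare_le_of_weight_le hW hlw hi).trans ?_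
      gcongr
      rw [hlne j' hj']
      exact hge j'

/-- The machines on which enforcers are placed: those at or next to the end of a block. -/
def IsTarget (w : Fin m → ℕ → ℝ≥0∞) (u : Fin m → ℕ) (j : Fin m) : Prop :=
  IsFull (w j) (u j) ∨ IsFull (w j) (u j + 1)

theorem IsTarget.three_le (hW : Weighting c n β w) {j : Fin m} (h : IsTarget w u j) : 3 ≤ u j := by
  rcases h with h | h <;> have := h.four_le (hW.block j) <;> omega

/-- Realizes the numbers `a` of enforcers on a filling. -/
theorem exists_profile_of_filling [Nonempty (Fin m)] (hu : ∑ j, u j = S.card) {a : Fin m → ℕ}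
    (hau : ∀ j, a j ≤ u j) {f : A → Fin m}
    (hf : ∀ j, ((S ∩ D).filter fun i => f i = j).card = a j) (ha : ∑ j, a j = (S ∩ D).card) :
    ∃ s : Profile S m, RegularsSorted D s ∧ (∀ i (h : i ∈ S), i ∈ D → s ⟨i, h⟩ = f i) ∧
      ∀ j, (users s j ∩ D).card = a j ∧ (users s j).card = u j := by
  obtain ⟨s, h1, h2, h3⟩ := exists_profile (b := fun j => u j - a j) (D := D) (S := S) (by
    rw [Finset.sum_tsub_distrib _ (fun j _ => hau j), hu, ha]
    have := Finset.card_inter_add_card_sdiff S D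
    omega) hf
  exact ⟨s, h1, h2, fun j => ⟨(h3 j).1, by rw [(h3 j).2]; have := hau j; omega⟩⟩

/-- Two enforcers on each target make a newcomer the third, at the default charge. On a non-target a
lone enforcer is dangerous, since a second one gets the pair discount if `u j + 2` is full; load one
is too small for that. -/
theorem exists_pne_many (hW : Weighting c n β w) (hu : ∑ j, u j = S.card)
    (hF : IsFilling w M t u) {a : Fin m → ℕ} (hau : ∀ j, a j ≤ u j)
    (ha : ∑ j, a j = (S ∩ D).card) (ha2 : ∀ j, IsTarget w u j → 2 ≤ a j)
    (ha1 : ∀ j, ¬ IsTarget w u j → a j = 1 → u j = 1) : ∃ s : Profile S m, UsersPNE c β w D s := by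
  have : Nonempty (Fin m) := ⟨t⟩
  obtain ⟨f, -, hf⟩ := exists_monotone_assignment (S ∩ D) a ha
  obtain ⟨s, hsort, -, hcard⟩ := exists_profile_of_filling hu hau hf ha
  have hlw : ∀ j, w j (users s j).card ≤ M := fun j => by rw [(hcard j).2]; exact hF.le j
  refine ⟨s, usersPNE_of_sorted hW hsort hlw (fun j => by rw [(hcard j).2]; exact hF.ge j) ?_ ?_⟩
  · intro j hj
    rw [(hcard j).2] at hj
    rw [(hcard j).1]
    exact ha2 j (Or.inr hj)
  · intro j i hi hiD j' hne
    refine (blockShare_le_of_weight_le hW hlw hi).trans ?_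
    rw [(hcard j').1, (hcard j').2]
    suffices h : enfShare β (w j') (a j' + 1) (u j' + 1) (Mechanism.roleRank D (users s j') i) =
        β * (4 * w j' (u j' + 1)) by
      rw [h]
      gcongr
      exact hF.ge j'
    have hw := hW.block j'
    by_cases hT : IsTarget w u j'
    · exact enfShare_many (by have := ha2 j' hT; omega)
    · rcases (by omega : a j' = 0 ∨ a j' = 1 ∨ 2 ≤ a j') with h | h | h
      · rw [h]
        rw [IsTarget, not_or] at hT
        exact enfShare_one_other hT.2 (by simpa using hT.1)
      · rw [h, ha1 j' hT h]
        exact enfShare_two_other (not_isFull_of_le hw (by norm_num))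
          (not_isFull_of_le hw (by norm_num)) (not_isFull_of_le hw (by norm_num))
      · exact enfShare_many (by omega)

end Existence

end Profiles

/-! ### Placing the enforcers -/

section Existence

variable {A : Type*} [LinearOrder A] {m n : ℕ} {c : Fin m → CostFn} {β : ℝ≥0∞}
  {w : Fin m → ℕ → ℝ≥0∞} {D S : Finset A} {M : ℝ≥0∞} {t : Fin m} {u : Fin m → ℕ}

theorem IsFilling.eq_of_near (hW : Weighting c n β w) (hF : IsFilling w M t u) {j : Fin m}
    (h : IsFull (w j) (u j + 1)) : j = t := by
  by_contra hj
  have h4 := h.four_le (hW.block j)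
  exact (hF.full j hj (by omega)).not_add (hW.block j) le_rfl (by norm_num) h

theorem exists_assignment_pairs {P L : Finset (Fin m)} (hL : L.card ≤ 1) (hPL : Disjoint P L)
    {R : Finset A} (hR : 2 * P.card + L.card = R.card) [Nonempty (Fin m)] :
    ∃ a : Fin m → ℕ, (∀ j ∈ P, a j = 2) ∧ (∀ j ∈ L, a j = 1) ∧ (∀ j, j ∉ P → j ∉ L → a j = 0) ∧
      ∑ j, a j = R.card ∧ ∃ f : A → Fin m, (∀ j, (R.filter fun i => f i = j).card = a j) ∧
        ∀ j ∈ L, ∀ y ∈ R, f y = j → ∀ x ∈ R, x ≤ y := by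
  classical
  let a : Fin m → ℕ := fun j => (if j ∈ P then 2 else 0) + if j ∈ L then 1 else 0
  have hsum : ∑ j, a j = R.card := by
    simp only [a, Finset.sum_add_distrib, Finset.sum_ite_mem, Finset.univ_inter, Finset.sum_const,
      smul_eq_mul]
    omega
  have hP : ∀ j ∈ P, a j = 2 := fun j hj => by
    simp [a, hj, Finset.disjoint_left.1 hPL hj]
  have hLa : ∀ j ∈ L, a j = 1 := fun j hj => by
    simp [a, hj, Finset.disjoint_right.1 hPL hj]
  refine ⟨a, hP, hLa, fun j h1 h2 => by simp [a, h1, h2], hsum, ?_⟩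
  rcases L.eq_empty_or_nonempty with rfl | ⟨j₁, hj₁⟩
  · obtain ⟨f, -, hf⟩ := exists_monotone_assignment R a hsum
    exact ⟨f, hf, by simp⟩
  · obtain ⟨f, hf, hlast⟩ := exists_assignment_last hsum (hLa j₁ hj₁)
    refine ⟨f, hf, fun j hj => ?_⟩
    rw [Finset.card_le_one.1 hL j hj j₁ hj₁]
    exact hlast

/-- Pairs take the heaviest targets, so they pay no more than the attraction price of a target
without enforcers. An unpaired enforcer pays only `β`; being last in priority, it gives newcomers
rank zero and the default charge. A nearly full machine must be `t`, the heaviest of all, so it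
receives a pair, which deters regulars from completing its block. -/
theorem exists_pne_few (hW : Weighting c n β w) (hu : ∑ j, u j = S.card)
    (hF : IsFilling w M t u) {C : Finset (Fin m)} (hC : ∀ j, j ∈ C ↔ IsTarget w u j)
    (hr : (S ∩ D).card ≤ 2 * C.card) (hnear : IsFull (w t) (u t + 1) → 2 ≤ (S ∩ D).card) :
    ∃ s : Profile S m, UsersPNE c β w D s := by
  classical
  have : Nonempty (Fin m) := ⟨t⟩
  obtain ⟨P, hPC, hPcard, hPtop⟩ := exists_top_subset C (fun j => w j (u j))
    (k := (S ∩ D).card / 2) (by omega)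
  obtain ⟨L, hLC, hLcard⟩ := Finset.exists_subset_card_eq (s := C \ P) (n := (S ∩ D).card % 2) (by
    rw [Finset.card_sdiff_of_subset hPC]
    omega)
  have hPL : Disjoint P L := Finset.disjoint_left.2 fun j hj hj' =>
    (Finset.mem_sdiff.1 (hLC hj')).2 hj
  have hL1 : L.card ≤ 1 := by omega
  obtain ⟨a, haP, haL, ha0, hasum, f, hf, hlast⟩ :=
    exists_assignment_pairs hL1 hPL (R := S ∩ D) (by omega)
  have hmemC : ∀ j, j ∈ P ∨ j ∈ L → IsTarget w u j := fun j hj =>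
    (hC j).1 (hj.elim (fun h => hPC h) fun h => (Finset.mem_sdiff.1 (hLC h)).1)
  have hau : ∀ j, a j ≤ u j := by
    intro j
    by_cases hjP : j ∈ P
    · have := (hmemC j (Or.inl hjP)).three_le hW
      rw [haP j hjP]; omega
    by_cases hjL : j ∈ L
    · have := (hmemC j (Or.inr hjL)).three_le hW
      rw [haL j hjL]; omega
    · rw [ha0 j hjP hjL]; omega
  have hnearP : ∀ j, IsFull (w j) (u j + 1) → j ∈ P := by
    intro j hj
    have hjt := hF.eq_of_near hW hj
    subst hjt
    by_contra hjP
    have h2 := hnear hj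
    obtain ⟨j₂, hj₂⟩ : P.Nonempty := Finset.card_pos.1 (by omega)
    have := hPtop j₂ hj₂ j ((hC j).2 (Or.inr hj)) hjP
    have hne : j₂ ≠ j := fun h => hjP (h ▸ hj₂)
    rw [hF.top] at this
    exact absurd (hF.lt j₂ hne) (not_lt.2 this)
  have hfullC : ∀ j, j ∉ P → IsTarget w u j → IsFull (w j) (u j) := fun j hjP hj =>
    hj.elim id fun h => absurd (hnearP j h) hjP
  obtain ⟨s, hsort, hsf, hcard⟩ := exists_profile_of_filling hu hau hf hasum
  have hlw : ∀ j, w j (users s j).card ≤ M := fun j => by rw [(hcard j).2]; exact hF.le j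
  refine ⟨s, usersPNE_of_sorted hW hsort hlw (fun j => by rw [(hcard j).2]; exact hF.ge j) ?_ ?_⟩
  · intro j hj
    rw [(hcard j).2] at hj
    rw [(hcard j).1, haP j (hnearP j hj)]
  · intro j i hi hiD j' hne
    have hbound := blockShare_le_of_weight_le (D := D) hW hlw hi
    have hbound' : blockShare c β w D j (users s j) i ≤ β * (4 * w j' (u j' + 1)) := by
      refine hbound.trans ?_
      gcongr
      exact hF.ge j'
    have haj : 1 ≤ a j := by
      rw [← (hcard j).1]; exact Finset.card_pos.2 ⟨i, Finset.mem_inter.2 ⟨hi, hiD⟩⟩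
    rw [(hcard j').1, (hcard j').2]
    have hw' := hW.block j'
    by_cases hjP' : j' ∈ P
    · rw [haP j' hjP', enfShare_many le_rfl]
      exact hbound'
    by_cases hjL' : j' ∈ L
    · have hrank : Mechanism.roleRank D (users s j') i = 0 := by
        rw [roleRank_of_mem hiD, Finset.card_eq_zero, Finset.filter_eq_empty_iff]
        intro y hy
        rw [Finset.mem_inter] at hy
        obtain ⟨hyS, hyj⟩ := mem_users.1 hy.1
        obtain ⟨hiS, -⟩ := mem_users.1 hi
        rw [hsf y hyS hy.2] at hyj
        exact not_lt.2 (hlast j' hjL' y (Finset.mem_inter.2 ⟨hyS, hy.2⟩) hyj i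
          (Finset.mem_inter.2 ⟨hiS, hiD⟩))
      have hfull := hfullC j' hjP' (hmemC j' (Or.inr hjL'))
      rw [haL j' hjL', hrank, enfShare_two_zero (hfull.not_add hw' le_rfl (by norm_num))
        (by rw [add_assoc]; exact hfull.not_add hw' (by norm_num) (by norm_num))]
      exact hbound'
    rw [ha0 j' hjP' hjL', zero_add]
    by_cases hT : IsTarget w u j'
    · rw [enfShare_one_over hw' (hfullC j' hjP' hT), blockShare, if_pos hiD, (hcard j).1,
        (hcard j).2]
      by_cases hjP : j ∈ P
      · rw [haP j hjP, enfShare_two_full (hmemC j (Or.inl hjP))]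
        gcongr
        exact hPtop j hjP j' ((hC j').2 hT) hjP'
      · have hjL : j ∈ L := by
          by_contra h
          rw [ha0 j hjP h] at haj
          omega
        rw [haL j hjL, enfShare_one_full (hfullC j hjP (hmemC j (Or.inr hjL)))]
        exact le_mul_of_one_le_right zero_le le_self_add
    · rw [IsTarget, not_or] at hT
      rw [enfShare_one_other hT.2 (by simpa using hT.1)]
      exact hbound'

theorem exists_usersPNE (hW : Weighting c n β w) (hS : S.card ≤ n) (hS0 : S.Nonempty)
    [Nonempty (Fin m)] : ∃ s : Profile S m, UsersPNE c β w D s := by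
  classical
  obtain ⟨M, t, u, hu, hF⟩ := exists_isFilling hW hS0.card_pos hS
  by_cases hsingle : ∀ j, j ≠ t → u j = 0
  · exact exists_pne_single hW hu hF hsingle
  push Not at hsingle
  obtain ⟨j₂, hj₂, hu₂⟩ := hsingle
  by_cases hvac : IsFull (w t) (u t + 1) ∧ (S ∩ D).card ≤ 1
  · exact exists_pne_vacancy hW hu hF hvac.1 hvac.2 hj₂ (by omega)
  set C := Finset.univ.filter fun j => IsTarget w u j with hCdef
  have hC : ∀ j, j ∈ C ↔ IsTarget w u j := by simp [hCdef]
  rcases le_or_gt (S ∩ D).card (2 * C.card) with hr | hr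
  · refine exists_pne_few hW hu hF hC hr fun h => ?_
    by_contra h2
    exact hvac ⟨h, by omega⟩
  have hne : ∀ j, j ≠ t → ¬ IsTarget w u j → u j = 0 := by
    intro j hj hT
    by_contra h
    exact hT (Or.inl (hF.full j hj (by omega)))
  have hCpos : 1 ≤ C.card := by
    refine Finset.card_pos.2 ⟨j₂, (hC j₂).2 ?_⟩
    by_contra h
    exact hu₂ (hne j₂ hj₂ h)
  have hlosum : ∑ j, (if IsTarget w u j then 2 else 0) = 2 * C.card := by
    rw [← Finset.sum_filter, Finset.sum_const, smul_eq_mul, mul_comm]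
  have hrS : (S ∩ D).card ≤ ∑ j, u j := hu ▸ Finset.card_le_card Finset.inter_subset_left
  by_cases hT : IsTarget w u t
  · obtain ⟨a, h1, h2, h3⟩ := exists_between (lo := fun j => if IsTarget w u j then 2 else 0)
      (hi := u) (r := (S ∩ D).card) (fun j => by
        split_ifs with h
        · have := h.three_le hW; omega
        · omega) (by omega) hrS
    refine exists_pne_many hW hu hF h2 h3 (fun j hj => by simpa [hj] using h1 j) fun j hj haj => ?_
    have := hne j (fun h => hj (h ▸ hT)) hj
    have := h2 j
    omega
  -- Since `t` is not a target here, a lone enforcer on it has to be avoided unless its load is one: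
  -- it gets none if the others have room, and at least `min 2 (u t)` otherwise.
  set hi := Function.update u t 0 with hhi
  have hhit : hi t = 0 := by simp [hhi]
  have hhine : ∀ j, j ≠ t → hi j = u j := fun j hj => by simp [hhi, hj]
  have hhile : ∀ j, hi j ≤ u j := by
    intro j
    by_cases h : j = t
    · subst h; omega
    · rw [hhine j h]
  have hCt : ∀ j, IsTarget w u j → j ≠ t := fun j hj h => hT (h ▸ hj)
  rcases le_or_gt (S ∩ D).card (∑ j, hi j) with hrhi | hrhi
  · obtain ⟨a, h1, h2, h3⟩ := exists_between (lo := fun j => if IsTarget w u j then 2 else 0)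
      (hi := hi) (r := (S ∩ D).card) (fun j => by
        split_ifs with h
        · have := h.three_le hW; rw [hhine j (hCt j h)]; omega
        · omega) (by omega) hrhi
    refine exists_pne_many hW hu hF (fun j => (h2 j).trans (hhile j)) h3
      (fun j hj => by simpa [hj] using h1 j) fun j hj haj => ?_
    have h4 := h2 j
    by_cases h : j = t
    · subst h; omega
    · have := hne j h hj
      rw [hhine j h] at h4
      omega
  -- Targets have load at least three, so there are at least `3|C| + 1 ≥ 2|C| + 2` enforcers: enough
  -- for the pairs on targets and two more on `t`.
  · have h3C : 3 * C.card ≤ ∑ j, hi j := by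
      calc 3 * C.card = ∑ j ∈ C, 3 := by rw [Finset.sum_const, smul_eq_mul, mul_comm]
        _ ≤ ∑ j ∈ C, hi j := Finset.sum_le_sum fun j hj => by
            have hj' := (hC j).1 hj
            rw [hhine j (hCt j hj')]
            exact hj'.three_le hW
        _ ≤ ∑ j, hi j := Finset.sum_le_sum_of_subset (Finset.subset_univ _)
    obtain ⟨a, h1, h2, h3⟩ := exists_between
      (lo := fun j => (if IsTarget w u j then 2 else 0) + if j = t then min 2 (u t) else 0)
      (hi := u) (r := (S ∩ D).card) (fun j => by
        by_cases h : IsTarget w u j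
        · have := h.three_le hW
          rw [if_pos h, if_neg (hCt j h)]
          omega
        · rw [if_neg h]
          split_ifs with h₁
          · rw [h₁]; omega
          · omega) (by
          rw [Finset.sum_add_distrib, hlosum, Finset.sum_ite_eq' Finset.univ t,
            if_pos (Finset.mem_univ t)]
          omega) hrS
    refine exists_pne_many hW hu hF h2 h3 (fun j hj => ?_) fun j hj haj => ?_
    · have := h1 j
      rw [if_pos hj] at this
      omega
    · have h4 := h1 j
      have h5 := h2 j
      by_cases h : j = t
      · subst h
        rw [if_pos rfl] at h4
        omega
      · have := hne j h hj
        omega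

end Existence

/-! ### Stability and the reduction to an expectation -/

section Main

variable {A : Type*} [LinearOrder A] [Fintype A] [Nonempty A] {D : Finset A}

theorem stable_enforcerMechanism : (enforcerMechanism D).Stable := by
  intro m c hc S
  obtain ⟨β, w, hW, hX⟩ := enforcerMechanism_share (D := D) hc
  simp only [isPNE_iff_usersPNE hX]
  rcases S.eq_empty_or_nonempty with rfl | hS
  · exact ⟨fun i => absurd i.2 (Finset.notMem_empty _), fun j i hi =>
      absurd (mem_users.1 hi).1 (Finset.notMem_empty _)⟩
  · have : Nonempty (Fin m) := by
      by_contra hm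
      rw [not_nonempty_iff] at hm
      have : IsEmpty (Profile (Finset.univ : Finset A) m) :=
        ⟨fun s => hm.false (s ⟨Classical.arbitrary A, Finset.mem_univ _⟩)⟩
      exact hc.2 (by simp [optCost])
    exact exists_usersPNE hW S.card_le_univ hS

theorem expectedPoA_enforcerMechanism_le (p : ℝ) :
    (enforcerMechanism D).expectedPoA p ≤ ∑ S : Finset A, arrivalProb p S * poaBound D S := by
  refine iSup_le fun m => iSup_le fun c => iSup_le fun hc => Finset.sum_le_sum fun S _ => ?_
  obtain ⟨β, w, hW, hX⟩ := enforcerMechanism_share (D := D) hc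
  gcongr
  exact PoA_le_poaBound hW hX S.card_le_univ

end Main

/-! ### Random arrivals -/

section Arrival

theorem card_inter_eq_sum {A : Type*} [DecidableEq A] (S D : Finset A) :
    ((S ∩ D).card : ℝ) = ∑ i ∈ D, if i ∈ S then 1 else 0 := by
  rw [Finset.sum_boole, Finset.filter_mem_eq_inter, Finset.inter_comm]

variable {A : Type*} [Fintype A] {p : ℝ}

/-- The probability of the set `S` of arrivals as a real number. -/
noncomputable def arrivalWeight (p : ℝ) (S : Finset A) : ℝ :=
  p ^ S.card * (1 - p) ^ (Fintype.card A - S.card)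

theorem arrivalWeight_nonneg (h0 : 0 ≤ p) (h1 : p ≤ 1) (S : Finset A) :
    0 ≤ arrivalWeight p S :=
  mul_nonneg (pow_nonneg h0 _) (pow_nonneg (sub_nonneg.2 h1) _)

variable [DecidableEq A]

/-- Expand a product over agents with one factor for arriving and one for staying away; zeroing the
forbidden factor on `U` and `V` removes exactly the unwanted sets. -/
theorem sum_arrivalWeight_filter {U V : Finset A} (h : Disjoint U V) :
    ∑ S : Finset A, (if U ⊆ S ∧ Disjoint V S then arrivalWeight p S else 0) =
      p ^ U.card * (1 - p) ^ V.card := by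
  have key := Finset.prod_add (fun a => if a ∈ V then 0 else p)
    (fun a => if a ∈ U then 0 else 1 - p) (Finset.univ : Finset A)
  rw [Finset.powerset_univ] at key
  have hL : ∏ a : A, ((if a ∈ V then 0 else p) + if a ∈ U then 0 else 1 - p) =
      p ^ U.card * (1 - p) ^ V.card := by
    have : ∀ a : A, ((if a ∈ V then 0 else p) + if a ∈ U then 0 else 1 - p) =
        (if a ∈ U then p else 1) * if a ∈ V then 1 - p else 1 := by
      intro a
      by_cases hU : a ∈ U
      · simp [hU, Finset.disjoint_left.1 h hU]
      · by_cases hV : a ∈ V <;> simp [hU, hV]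
    simp_rw [this]
    rw [Finset.prod_mul_distrib]
    simp
  rw [← hL, key]
  refine Finset.sum_congr rfl fun S _ => ?_
  rw [← Finset.compl_eq_univ_sdiff]
  split_ifs with hS
  · rw [Finset.prod_congr rfl (g := fun _ => p) fun a ha => if_neg fun hV =>
        Finset.disjoint_left.1 hS.2 hV ha,
      Finset.prod_congr rfl (g := fun _ => 1 - p) fun a ha => if_neg fun hU =>
        Finset.mem_compl.1 ha (hS.1 hU),
      Finset.prod_const, Finset.prod_const, Finset.card_compl, arrivalWeight]
  · rw [not_and_or] at hS
    symm
    rcases hS with hS | hS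
    · obtain ⟨a, haU, haS⟩ := Finset.not_subset.1 hS
      refine mul_eq_zero_of_right _ (Finset.prod_eq_zero (i := a) ?_ ?_)
      · exact Finset.mem_compl.2 haS
      · exact if_pos haU
    · obtain ⟨a, haV, haS⟩ := Finset.not_disjoint_iff.1 hS
      refine mul_eq_zero_of_left (Finset.prod_eq_zero haS ?_) _
      exact if_pos haV

theorem sum_arrivalWeight : ∑ S : Finset A, arrivalWeight p S = 1 := by
  simpa using sum_arrivalWeight_filter (p := p) (Finset.disjoint_empty_right (∅ : Finset A))

theorem sum_arrivalWeight_mul_card_inter (D : Finset A) :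
    ∑ S : Finset A, arrivalWeight p S * (S ∩ D).card = D.card * p := by
  simp_rw [card_inter_eq_sum, Finset.mul_sum]
  rw [Finset.sum_comm, ← nsmul_eq_mul, ← Finset.sum_const]
  refine Finset.sum_congr rfl fun i _ => ?_
  simpa using sum_arrivalWeight_filter (p := p) (Finset.disjoint_empty_right {i})

/-- If at most one agent of `D` arrives, the arriving agents outside `D` can be counted by
distinguishing whether none or exactly one does. -/
theorem card_le_of_card_inter_lt_two {S D : Finset A} (h : (S ∩ D).card < 2) :
    (S.card : ℝ) ≤ 1 + ∑ i ∈ Dᶜ, ((if {i} ⊆ S ∧ Disjoint D S then 1 else 0) +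
      ∑ e ∈ D, if {i, e} ⊆ S ∧ Disjoint (D.erase e) S then 1 else 0) := by
  have hsplit : (S.card : ℝ) = (S ∩ D).card + (S ∩ Dᶜ).card := by
    rw [← Nat.cast_add, ← Finset.card_union_of_disjoint, ← Finset.inter_union_distrib_left,
      Finset.union_compl, Finset.inter_univ]
    exact disjoint_compl_right.mono Finset.inter_subset_right Finset.inter_subset_right
  rw [hsplit, card_inter_eq_sum S Dᶜ]
  refine add_le_add (by exact_mod_cast Nat.lt_succ_iff.1 h) (Finset.sum_le_sum fun i _ => ?_)
  have hnn : ∀ e ∈ D,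
      (0 : ℝ) ≤ if {i, e} ⊆ S ∧ Disjoint (D.erase e) S then 1 else 0 := fun e _ => by
    split_ifs <;> norm_num
  split_ifs with hi hD hD
  · exact le_add_of_nonneg_right (Finset.sum_nonneg hnn)
  · rw [zero_add]
    obtain ⟨e, heD, heS⟩ := Finset.not_disjoint_iff.1 fun hd =>
      hD ⟨Finset.singleton_subset_iff.2 hi, hd⟩
    refine le_trans ?_ (Finset.single_le_sum hnn heD)
    rw [if_pos]
    refine ⟨Finset.insert_subset hi (Finset.singleton_subset_iff.2 heS),
      Finset.disjoint_left.2 fun a ha haS => (Finset.mem_erase.1 ha).1 ?_⟩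
    exact Finset.card_le_one.1 (Nat.lt_succ_iff.1 h) a
      (Finset.mem_inter.2 ⟨haS, Finset.mem_of_mem_erase ha⟩) e (Finset.mem_inter.2 ⟨heS, heD⟩)
  · exact add_nonneg zero_le_one (Finset.sum_nonneg hnn)
  · exact add_nonneg le_rfl (Finset.sum_nonneg hnn)

/-- An outside agent arrives with no enforcer, or with exactly one enforcer `e`; these events have
probabilities `p(1-p)^d` and `p²(1-p)^(d-1)`, where `d = |D|`. The summand `1` covers the enforcer
itself. -/
theorem sum_arrivalWeight_mul_card_le (h0 : 0 ≤ p) (h1 : p ≤ 1) (D : Finset A) :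
    ∑ S : Finset A, (if (S ∩ D).card < 2 then arrivalWeight p S * S.card else 0) ≤
      1 + (Dᶜ.card : ℝ) * (p * (1 - p) ^ D.card +
        D.card * (p ^ 2 * (1 - p) ^ (D.card - 1))) := by
  have hle : ∀ S : Finset A, (if (S ∩ D).card < 2 then arrivalWeight p S * S.card else 0) ≤
      arrivalWeight p S + ∑ i ∈ Dᶜ, ((if {i} ⊆ S ∧ Disjoint D S then arrivalWeight p S else 0) +
        ∑ e ∈ D, if {i, e} ⊆ S ∧ Disjoint (D.erase e) S then arrivalWeight p S else 0) := by
    intro S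
    have hw := arrivalWeight_nonneg h0 h1 S
    split_ifs with h
    · refine (mul_le_mul_of_nonneg_left (card_le_of_card_inter_lt_two h) hw).trans_eq ?_
      simp only [mul_add, Finset.mul_sum, mul_ite, mul_one, mul_zero]
    · refine add_nonneg hw (Finset.sum_nonneg fun i _ => add_nonneg ?_
        (Finset.sum_nonneg fun e _ => ?_)) <;> split_ifs <;> first | exact hw | exact le_rfl
  refine (Finset.sum_le_sum fun S _ => hle S).trans_eq ?_
  rw [Finset.sum_add_distrib, sum_arrivalWeight, Finset.sum_comm, ← nsmul_eq_mul,
    ← Finset.sum_const]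
  congr 1
  refine Finset.sum_congr rfl fun i hi => ?_
  have hi' := Finset.mem_compl.1 hi
  rw [Finset.sum_add_distrib, sum_arrivalWeight_filter (Finset.disjoint_singleton_left.2 hi'),
    Finset.sum_comm, ← nsmul_eq_mul, ← Finset.sum_const, Finset.card_singleton, pow_one]
  congr 1
  refine Finset.sum_congr rfl fun e he => ?_
  have hie : i ≠ e := fun h => hi' (h ▸ he)
  rw [sum_arrivalWeight_filter, Finset.card_pair hie, Finset.card_erase_of_mem he]
  refine Finset.disjoint_left.2 fun a ha ha' => ?_
  rcases Finset.mem_insert.1 ha with rfl | ha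
  · exact hi' (Finset.mem_of_mem_erase ha')
  · exact (Finset.mem_erase.1 ha').1 (Finset.mem_singleton.1 ha)

theorem sum_arrivalProb_mul_poaBound_le {A : Type*} [LinearOrder A] [Fintype A] {p : ℝ}
    (h0 : 0 ≤ p) (h1 : p ≤ 1) (D : Finset A) :
    ∑ S, arrivalProb p S * poaBound D S ≤ ENNReal.ofReal (64 + 48 * (D.card * p) +
      16 * (Dᶜ.card * (p * (1 - p) ^ D.card +
        D.card * (p ^ 2 * (1 - p) ^ (D.card - 1))))) := by
  have hle : ∀ S : Finset A, arrivalProb p S * poaBound D S ≤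
      ENNReal.ofReal (48 * arrivalWeight p S + 48 * (arrivalWeight p S * (S ∩ D).card) +
        16 * if (S ∩ D).card < 2 then arrivalWeight p S * S.card else 0) := by
    intro S
    have hw := arrivalWeight_nonneg h0 h1 S
    unfold poaBound
    rw [show arrivalProb p S = ENNReal.ofReal (arrivalWeight p S) from rfl]
    by_cases h : (S ∩ D).card < 2
    · rw [if_neg (not_le.2 h), if_pos h,
        show (16 * S.card : ℝ≥0∞) = ENNReal.ofReal (16 * S.card) by
          rw [ENNReal.ofReal_mul (by norm_num)]; simp, ← ENNReal.ofReal_mul hw]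
      refine ENNReal.ofReal_le_ofReal ?_
      have : 0 ≤ arrivalWeight p S * (S ∩ D).card := by positivity
      linarith
    · rw [if_pos (not_lt.1 h), if_neg h,
        show (48 * (1 + (S ∩ D).card) : ℝ≥0∞) = ENNReal.ofReal (48 * (1 + (S ∩ D).card)) by
          rw [ENNReal.ofReal_mul (by norm_num), ENNReal.ofReal_add (by norm_num) (by positivity)]
          simp, ← ENNReal.ofReal_mul hw]
      refine ENNReal.ofReal_le_ofReal (le_of_eq ?_)
      ring
  refine (Finset.sum_le_sum fun S _ => hle S).trans ?_
  rw [← ENNReal.ofReal_sum_of_nonneg]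
  · refine ENNReal.ofReal_le_ofReal ?_
    rw [Finset.sum_add_distrib, Finset.sum_add_distrib, ← Finset.mul_sum, ← Finset.mul_sum,
      ← Finset.mul_sum, sum_arrivalWeight, sum_arrivalWeight_mul_card_inter]
    have := sum_arrivalWeight_mul_card_le h0 h1 D
    linarith
  · intro S _
    have hw := arrivalWeight_nonneg h0 h1 S
    split_ifs <;> positivity

end Arrival

/-! ### The number of enforcers -/

section Estimate

variable {n : ℕ} {p : ℝ}

theorem numEnforcers_le (n : ℕ) (p : ℝ) : numEnforcers n p ≤ n := min_le_left _ _

theorem numEnforcers_mul_le (h0 : 0 < p) (h1 : p ≤ 1) :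
    numEnforcers n p * p ≤ 3 + 3 * max 0 (Real.log (p * n)) := by
  set l := Real.log (p * n)
  set y := 3 * l / (-Real.log (1 - p)) with hy
  -- The inequality cancels the denominator of the quotient. At `p = 1` the convention `Real.log 0 =
  -- 0` and division by zero give the quotient `0`, as intended.
  have hlog : p ≤ -Real.log (1 - p) ∨ p = 1 := by
    rcases h1.eq_or_lt with h | h
    · exact Or.inr h
    · have := Real.log_le_sub_one_of_pos (sub_pos.2 h)
      exact Or.inl (by linarith)
  have hyp : y * p ≤ 3 * max 0 l := by
    rcases hlog with h | h
    · have hq : 0 < -Real.log (1 - p) := h0.trans_le h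
      have h2 : y ≤ 3 * max 0 l / (-Real.log (1 - p)) := by
        rw [hy]; gcongr; exact le_max_right _ _
      calc y * p ≤ 3 * max 0 l / (-Real.log (1 - p)) * p := by gcongr
        _ ≤ 3 * max 0 l / (-Real.log (1 - p)) * (-Real.log (1 - p)) := by gcongr
        _ = 3 * max 0 l := div_mul_cancel₀ _ hq.ne'
    · have : y = 0 := by rw [hy, h]; simp
      rw [this, zero_mul]; positivity
  have hd : (numEnforcers n p : ℝ) ≤ max 0 (3 + y) := by
    have h2 : numEnforcers n p ≤ (3 + ⌊y⌋).toNat := min_le_right _ _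
    calc (numEnforcers n p : ℝ) ≤ ((3 + ⌊y⌋).toNat : ℝ) := by exact_mod_cast h2
      _ = ((max (3 + ⌊y⌋) 0 : ℤ) : ℝ) := by rw [← Int.toNat_eq_max, Int.cast_natCast]
      _ ≤ max 0 (3 + y) := by
        push_cast
        rw [max_comm]
        gcongr
        exact Int.floor_le y
  calc numEnforcers n p * p ≤ max 0 (3 + y) * p := by gcongr
    _ ≤ 3 + 3 * max 0 l := by
      rcases le_total 0 (3 + y) with h | h
      · rw [max_eq_right h]; linarith
      · rw [max_eq_left h]; have := le_max_left 0 l; linarith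

theorem mul_pow_numEnforcers_le (h0 : 0 < p) (h1 : p ≤ 1) :
    ((n - numEnforcers n p : ℕ) : ℝ) * (p * (1 - p) ^ numEnforcers n p +
      numEnforcers n p * (p ^ 2 * (1 - p) ^ (numEnforcers n p - 1))) ≤
        4 + 3 * max 0 (Real.log (p * n)) := by
  set d := numEnforcers n p with hd
  have hmul : (d : ℝ) * p ≤ 3 + 3 * max 0 (Real.log (p * n)) := numEnforcers_mul_le h0 h1
  have hq0 : 0 ≤ 1 - p := sub_nonneg.2 h1
  have hpow : (1 - p) ^ d ≤ (1 - p) ^ (d - 1) :=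
    pow_le_pow_of_le_one hq0 (by linarith) (Nat.sub_le _ _)
  have hmax := le_max_left 0 (Real.log (p * n))
  rcases (numEnforcers_le n p).eq_or_lt with hdn | hdn
  · rw [hd, hdn, Nat.sub_self, Nat.cast_zero, zero_mul]; positivity
  have hcast : ((n - d : ℕ) : ℝ) ≤ n := by exact_mod_cast Nat.sub_le _ _
  -- For `p * n > 1` and `p < 1`, the cutoff at `n` is inactive and `d - 1 = 2 + ⌊y⌋ ≥ y`, so the
  -- power is at most `(p * n)⁻³`; only the first power is needed.
  have hmain : p * n * (1 - p) ^ (d - 1) ≤ 1 := by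
    rcases le_or_gt (p * n) 1 with h | h
    · exact mul_le_one₀ h (by positivity) (pow_le_one₀ hq0 (by linarith))
    have hl : 0 < Real.log (p * n) := Real.log_pos h
    have hdeq : d = (3 + ⌊3 * Real.log (p * n) / (-Real.log (1 - p))⌋).toNat := by
      rcases min_choice n (3 + ⌊3 * Real.log (p * n) / (-Real.log (1 - p))⌋).toNat with h' | h'
      · exact absurd (h' : numEnforcers n p = n) hdn.ne
      · exact h'
    rcases h1.eq_or_lt with hp | hp
    · have : d = 3 := by rw [hdeq, hp]; simp
      rw [this, hp]; norm_num
    have hq : 0 < 1 - p := sub_pos.2 hp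
    have hlq : 0 < -Real.log (1 - p) := by
      have := Real.log_neg hq (by linarith)
      linarith
    set y := 3 * Real.log (p * n) / (-Real.log (1 - p)) with hy
    have hy0 : 0 ≤ y := by positivity
    have hfl : 0 ≤ ⌊y⌋ := Int.floor_nonneg.2 hy0
    have hdy : y ≤ ((d - 1 : ℕ) : ℝ) := by
      have h3 : ((d - 1 : ℕ) : ℤ) = 2 + ⌊y⌋ := by omega
      have h4 : ((d - 1 : ℕ) : ℝ) = 2 + ⌊y⌋ := by exact_mod_cast h3
      have := Int.lt_floor_add_one y
      linarith
    rw [← Real.log_nonpos_iff (by positivity), Real.log_mul (by positivity) (by positivity),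
      Real.log_pow]
    have h5 : y * (-Real.log (1 - p)) = 3 * Real.log (p * n) := div_mul_cancel₀ _ hlq.ne'
    have h6 := mul_le_mul_of_nonneg_right hdy hlq.le
    linarith
  calc ((n - d : ℕ) : ℝ) * (p * (1 - p) ^ d + d * (p ^ 2 * (1 - p) ^ (d - 1)))
      ≤ n * (p * (1 - p) ^ (d - 1) + d * (p ^ 2 * (1 - p) ^ (d - 1))) := by gcongr
    _ = p * n * (1 - p) ^ (d - 1) * (1 + d * p) := by ring
    _ ≤ 1 * (1 + d * p) := by gcongr
    _ ≤ 4 + 3 * max 0 (Real.log (p * n)) := by linarith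

end Estimate

end CostSharing

open CostSharing in
theorem mainTheorem7 :
    ∃ K : ℝ, 0 < K ∧
      ∀ (A : Type*) [LinearOrder A] [Fintype A] [Nonempty A] (p : ℝ), 0 < p → p ≤ 1 →
      ∀ D : Finset A, D.card = numEnforcers (Fintype.card A) p →
        ∃ X : Mechanism A, X.CoversCosts ∧ X.UsesEnforcers D ∧ X.Stable ∧
          X.expectedPoA p ≤
            ENNReal.ofReal (K * (1 + max 0 (Real.log (p * Fintype.card A)))) := by
  -- The constant terms add up to `64 + 48 * 3 + 16 * 4 = 272`; the coefficient of the logarithm is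
  -- only `48 * 3 + 16 * 3 = 192`.
  refine ⟨272, by norm_num, fun A _ _ _ p hp hp1 D hD => ⟨enforcerMechanism D,
    coversCosts_enforcerMechanism, usesEnforcers_enforcerMechanism, stable_enforcerMechanism,
    (expectedPoA_enforcerMechanism_le p).trans
      ((sum_arrivalProb_mul_poaBound_le hp.le hp1 D).trans (ENNReal.ofReal_le_ofReal ?_))⟩⟩
  have h1 := numEnforcers_mul_le (n := Fintype.card A) hp hp1
  have h2 := mul_pow_numEnforcers_le (n := Fintype.card A) hp hp1
  have h3 := le_max_left 0 (Real.log (p * Fintype.card A))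
  rw [Finset.card_compl, hD]
  linarith
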